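/- **Proposition 5.1.** Let $\Gamma$ be a totally ordered abelian group with positive cone $\Gamma^+=\{x\in\Gamma: x\ge 0\}$, let $A$ be a $C^*$-algebra, and let $\alpha:\Gamma^+\to\operatorname{Aut}A$ be an action by automorphisms ($\alpha_0=\mathrm{id}$, $\alpha_{x+y}=\alpha_x\alpha_y$). *Notation.* Let $B_{\Gamma^+}=\overline{\operatorname{span}}\{1_s: s\in\Gamma^+\}\subset\ell^\infty(\Gamma^+)$, where $1_s$ is the characteristic function of $\{x\in\Gamma^+: x\ge s\}$, and let $\tau_x$ be the endomorphism of $B_{\Gamma^+}$ given by right translation by $x$, so that $\tau_x(1_s)=1_{s+x}$. Let $\gamma$ be the action of $\Gamma^+$ by endomorphisms of the $C^*$-algebra $B_{\Gamma^+}\otimes A$ with $\gamma_x=\tau_x\otimes\alpha_x^{-1}$. Let $\beta$ be an action of $\Gamma^+$ by endomorphisms of a $C^*$-algebra $D$. * A *covariant partial-isometric representation* of $(D,\Gamma^+,\beta)$ on a Hilbert space $H$ is a pair $(\pi,V)$ of a non-degenerate representation $\pi:D\to B(H)$ and a map $V:\Gamma^+\to B(H)$ into partial isometries with $V_{s+t}=V_sV_t$,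 such that $\pi(\beta_s(d))=V_s\pi(d)V_s^*$ and $V_s^*V_s\pi(d)=\pi(d)V_s^*V_s$ for all $s\in\Gamma^+$, $d\in D$. It is a *covariant isometric representation* if instead the $V_s$ are isometries with $V_{s+t}=V_sV_t$ and $\pi(\beta_s(d))=V_s\pi(d)V_s^*$. The same relations define covariant pairs in a $C^*$-algebra $B$, consisting of a non-degenerate homomorphism $i_D:D\to B$ and a map $i_{\Gamma^+}:\Gamma^+\to M(B)$ into the multiplier algebra. * A *partial-isometric crossed product* of $(D,\Gamma^+,\beta)$ is a triple $(B,i_D,i_{\Gamma^+})$ such that (i) $(i_D,i_{\Gamma^+})$ is a covariant partial-isometric pair in $B$; (ii) for every covariant partial-isometric representation $(\pi,V)$ on a Hilbert space $H$ there is a non-degenerate representation $\pi\times V$ of $B$ on $H$ with $(\pi\times V)\circ i_D=\pi$ and $\overline{(\pi\times V)}\circ i_{\Gamma^+}=V$, where the bar denotes the canonical extension to $M(B)$; (iii) $B=\overline{\operatorname{span}}\{i_{\Gamma^+}(s)^*i_D(d)i_{\Gamma^+}(t): d\in D,\ s,t\in\Gamma^+\}$. It is denoted $D\times_\beta^{\mathrm{piso}}\Gamma^+$.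 * An *isometric crossed product* of $(D,\Gamma^+,\beta)$, denoted $D\times_\beta^{\mathrm{iso}}\Gamma^+$, is a triple $(B,i_D,i_{\Gamma^+})$ with (i) and (ii) for covariant isometric pairs and representations instead, such that $B$ is generated as a $C^*$-algebra by the elements $i_D(d)i_{\Gamma^+}(s)$. *Statement.* The system $(B_{\Gamma^+}\otimes A,\Gamma^+,\gamma)$ has an isometric crossed product. For every such isometric crossed product $(C,j_{B_{\Gamma^+}\otimes A},j_{\Gamma^+})$, the $C^*$-algebra $C$ together with $$k_A(a)=j_{B_{\Gamma^+}\otimes A}(1\otimes a)\quad(a\in A),\qquad k_{\Gamma^+}(x)=j_{\Gamma^+}(x)^*\quad(x\in\Gamma^+)$$ is a partial-isometric crossed product of $(A,\Gamma^+,\alpha)$. Hence $$A\times_\alpha^{\mathrm{piso}}\Gamma^+\;\cong\;(B_{\Gamma^+}\otimes A)\times_\gamma^{\mathrm{iso}}\Gamma^+ :$$ for every partial-isometric crossed product $(P,i_A,i_{\Gamma^+})$ of $(A,\Gamma^+,\alpha)$ there is an isomorphism $\Phi:P\to C$ with $\Phi\circ i_A=k_A$ and $\overline{\Phi}\circ i_{\Gamma^+}=k_{\Gamma^+}$.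 -/

import Mathlib

open scoped ENNReal TensorProduct MultiplierAlgebra

universe u v w

noncomputable section

namespace PisoCP

/-! ### Covariant representations and crossed products -/

section CrossedProducts

variable {S : Type v} [AddCommMonoid S] {A : Type u} [NonUnitalCStarAlgebra A]

/-- A partial-isometric representation `V` of the semigroup `S` in a `*`-semigroup `M`
(which will be `B(H)` or a multiplier algebra): each `V s` is a partial isometry
and `V (s + t) = V s * V t`. -/
structure IsPartialIsometricRep {M : Type w} [Mul M] [Star M] (V : S → M) : Prop where
  partialIsometry : ∀ s, V s * star (V s) * V s = V s
  map_add : ∀ s t, V (s + t) = V s * V t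

/-- An isometric representation `V` of `S`: each `V s` is an isometry and
`V (s + t) = V s * V t`. -/
structure IsIsometricRep {M : Type w} [Monoid M] [Star M] (V : S → M) : Prop where
  isometry : ∀ s, star (V s) * V s = 1
  map_add : ∀ s t, V (s + t) = V s * V t

/-- The relations of a partial-isometric covariant pair for the action `α` of `S` on `A` by
endomorphisms: `V` is a partial-isometric representation,
`π (α_s a) = V_s π(a) V_s^*` and `V_s^* V_s π(a) = π(a) V_s^* V_s`. -/
structure IsPisoCovariant (α : Multiplicative S →* (A →⋆ₙₐ[ℂ] A)) {M : Type w} [Mul M] [Star M]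
    (π : A → M) (V : S → M) : Prop where
  isRep : IsPartialIsometricRep V
  covariant : ∀ s a, π (α (.ofAdd s) a) = V s * π a * star (V s)
  commute : ∀ s a, star (V s) * V s * π a = π a * (star (V s) * V s)

/-- The relations of an isometric covariant pair: `V` is an isometric representation and
`π (α_s a) = V_s π(a) V_s^*`. -/
structure IsIsoCovariant (α : Multiplicative S →* (A →⋆ₙₐ[ℂ] A)) {M : Type w} [Monoid M] [Star M]
    (π : A → M) (V : S → M) : Prop where
  isRep : IsIsometricRep V
  covariant : ∀ s a, π (α (.ofAdd s) a) = V s * π a * star (V s)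

/-- A representation `π : A → B(H)` is non-degenerate if the vectors `π(a) h` span a dense
subspace of `H`. -/
def NondegenerateRep {H : Type w} [NormedAddCommGroup H] [InnerProductSpace ℂ H] [CompleteSpace H]
    (π : A →⋆ₙₐ[ℂ] (H →L[ℂ] H)) : Prop :=
  Dense (Submodule.span ℂ {k : H | ∃ a h, k = π a h} : Set H)

/-- A homomorphism `i : A → B` of C*-algebras is non-degenerate if the products `i(a) b`
span a dense subspace of `B`. -/
def NondegenerateHom {B : Type w} [NonUnitalCStarAlgebra B] (i : A →⋆ₙₐ[ℂ] B) : Prop :=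
  Dense (Submodule.span ℂ {c : B | ∃ a b, c = i a * b} : Set B)

/-- For a non-degenerate representation `ρ` of `B` on `H`, a multiplier `m ∈ M(B)` and an operator
`T`, this says `T = ρ̄(m)`, where `ρ̄ : M(B) → B(H)` is the canonical extension of `ρ`: it is the
operator determined by `ρ̄(m) ρ(b) = ρ(m b)` for all `b ∈ B`. -/
def ExtensionMaps {B : Type u} [NonUnitalCStarAlgebra B]
    {H : Type w} [NormedAddCommGroup H] [InnerProductSpace ℂ H] [CompleteSpace H]
    (ρ : B →⋆ₙₐ[ℂ] (H →L[ℂ] H)) (m : 𝓜(ℂ, B)) (T : H →L[ℂ] H) : Prop :=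
  ∀ b : B, T * ρ b = ρ (m.fst b)

/-- `(B, iA, iS)` is a partial-isometric crossed product of the system `(A, S, α)`. -/
structure IsPisoCrossedProduct (α : Multiplicative S →* (A →⋆ₙₐ[ℂ] A))
    {B : Type w} [NonUnitalCStarAlgebra B] (iA : A →⋆ₙₐ[ℂ] B) (iS : S → 𝓜(ℂ, B)) : Prop where
  nondegenerate : NondegenerateHom iA
  covariant : IsPisoCovariant α (fun a => (iA a : 𝓜(ℂ, B))) iS
  /-- every covariant partial-isometric representation `(π, V)` on a Hilbert space is induced by
  a non-degenerate representation `π × V` of `B` -/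
  universal : ∀ (H : Type w) [NormedAddCommGroup H] [InnerProductSpace ℂ H] [CompleteSpace H]
    (π : A →⋆ₙₐ[ℂ] (H →L[ℂ] H)) (V : S → (H →L[ℂ] H)),
    NondegenerateRep π → IsPisoCovariant α π V →
      ∃ ρ : B →⋆ₙₐ[ℂ] (H →L[ℂ] H), NondegenerateRep ρ ∧
        (∀ a, ρ (iA a) = π a) ∧ ∀ s, ExtensionMaps ρ (iS s) (V s)
  /-- `B` is the closed span of the elements `iS(s)^* iA(a) iS(t)` -/
  spanned : Dense (Submodule.span ℂ
    {b : B | ∃ s a t, (b : 𝓜(ℂ, B)) = star (iS s) * (iA a : 𝓜(ℂ, B)) * iS t} : Set B)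

/-- `(B, iA, iS)` is an isometric crossed product of the system `(A, S, α)`: the C*-algebra
generated by a universal isometric covariant representation. (The representation `ρ = π × V` of
`universal` is unique, by `generated`; and every non-degenerate representation of `B` arises
in this way, by `covariant`.) -/
structure IsIsoCrossedProduct (α : Multiplicative S →* (A →⋆ₙₐ[ℂ] A))
    {B : Type w} [NonUnitalCStarAlgebra B] (iA : A →⋆ₙₐ[ℂ] B) (iS : S → 𝓜(ℂ, B)) : Prop where
  nondegenerate : NondegenerateHom iA
  covariant : IsIsoCovariant α (fun a => (iA a : 𝓜(ℂ, B))) iS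
  universal : ∀ (H : Type w) [NormedAddCommGroup H] [InnerProductSpace ℂ H] [CompleteSpace H]
    (π : A →⋆ₙₐ[ℂ] (H →L[ℂ] H)) (V : S → (H →L[ℂ] H)),
    NondegenerateRep π → IsIsoCovariant α π V →
      ∃ ρ : B →⋆ₙₐ[ℂ] (H →L[ℂ] H), NondegenerateRep ρ ∧
        (∀ a, ρ (iA a) = π a) ∧ ∀ s, ExtensionMaps ρ (iS s) (V s)
  /-- `B` is generated, as a C*-algebra, by the elements `iA(a) iS(s)` -/
  generated : Dense (NonUnitalStarAlgebra.adjoin ℂ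
    {b : B | ∃ a s, (b : 𝓜(ℂ, B)) = (iA a : 𝓜(ℂ, B)) * iS s} : Set B)

/-- An action by automorphisms, viewed as an action by endomorphisms. -/
def endAction (α : Multiplicative S →* (A ≃⋆ₐ[ℂ] A)) : Multiplicative S →* (A →⋆ₙₐ[ℂ] A) where
  toFun s := (α s : A →⋆ₙₐ[ℂ] A)
  map_one' := by ext a; simp
  map_mul' s t := by ext a; rw [map_mul]; rfl

end CrossedProducts

/-! ### Closed spans -/

/-- If a subset `s` of a C*-algebra is closed under products and adjoints, then its closed linear
span is a C*-subalgebra. -/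
def closedSpan {E : Type u} [NonUnitalCStarAlgebra E] (s : Set E)
    (hmul : ∀ x ∈ s, ∀ y ∈ s, x * y ∈ s) (hstar : ∀ x ∈ s, star x ∈ s) :
    NonUnitalStarSubalgebra ℂ E where
  carrier := closure (Submodule.span ℂ s : Set E)
  add_mem' := fun hx hy => (Submodule.span ℂ s).topologicalClosure.add_mem hx hy
  zero_mem' := (Submodule.span ℂ s).topologicalClosure.zero_mem
  smul_mem' := fun c _ hx => (Submodule.span ℂ s).topologicalClosure.smul_mem c hx
  mul_mem' := fun hx hy => by
    refine map_mem_closure₂ continuous_mul hx hy fun a ha b hb => ?_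
    refine Submodule.span_induction₂ (p := fun x y _ _ => x * y ∈ Submodule.span ℂ s)
      ?_ ?_ ?_ ?_ ?_ ?_ ?_ ha hb
    · exact fun x y hx hy => Submodule.subset_span (hmul x hx y hy)
    · intro y _; simp
    · intro x _; simp
    · intro x y z _ _ _ h1 h2; rw [add_mul]; exact add_mem h1 h2
    · intro x y z _ _ _ h1 h2; rw [mul_add]; exact add_mem h1 h2
    · intro r x y _ _ h; rw [smul_mul_assoc]; exact Submodule.smul_mem _ r h
    · intro r x y _ _ h; rw [mul_smul_comm]; exact Submodule.smul_mem _ r h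
  star_mem' := fun hx => by
    refine map_mem_closure continuous_star hx fun a ha => ?_
    refine Submodule.span_induction (p := fun x _ => star x ∈ Submodule.span ℂ s) ?_ ?_ ?_ ?_ ha
    · exact fun x hx => Submodule.subset_span (hstar x hx)
    · simp
    · intro x y _ _ h1 h2; rw [star_add]; exact add_mem h1 h2
    · intro r x _ h; rw [star_smul]; exact Submodule.smul_mem _ _ h

theorem mem_closedSpan_of_mem {E : Type u} [NonUnitalCStarAlgebra E] {s : Set E}
    {hmul : ∀ x ∈ s, ∀ y ∈ s, x * y ∈ s} {hstar : ∀ x ∈ s, star x ∈ s} {x : E} (hx : x ∈ s) :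
    x ∈ closedSpan s hmul hstar :=
  subset_closure (Submodule.subset_span hx)

/-- A homomorphism of C*-algebras that sends the spanning set `s` into the spanning set `s'`
sends the closed span of `s` into that of `s'`. -/
theorem map_mem_closedSpan {E : Type u} {F : Type v}
    [NonUnitalCStarAlgebra E] [NonUnitalCStarAlgebra F] {s : Set E} {s' : Set F}
    {hmul : ∀ x ∈ s, ∀ y ∈ s, x * y ∈ s} {hstar : ∀ x ∈ s, star x ∈ s}
    {hmul' : ∀ x ∈ s', ∀ y ∈ s', x * y ∈ s'} {hstar' : ∀ x ∈ s', star x ∈ s'}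
    (φ : E →⋆ₙₐ[ℂ] F) (h : ∀ x ∈ s, φ x ∈ s') {x : E} (hx : x ∈ closedSpan s hmul hstar) :
    φ x ∈ closedSpan s' hmul' hstar' := by
  have hφ : Continuous φ :=
    AddMonoidHomClass.continuous_of_bound φ 1 fun x => by
      simpa only [one_mul] using NonUnitalStarAlgHom.norm_apply_le φ x
  refine map_mem_closure hφ hx fun a ha => ?_
  refine Submodule.span_induction (p := fun x _ => φ x ∈ Submodule.span ℂ s') ?_ ?_ ?_ ?_ ha
  · exact fun x hx => Submodule.subset_span (h x hx)
  · simp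
  · intro x y _ _ h1 h2; rw [map_add]; exact add_mem h1 h2
  · intro r x _ h; rw [map_smul]; exact Submodule.smul_mem _ _ h

instance isClosed_closedSpan {E : Type u} [NonUnitalCStarAlgebra E] (s : Set E)
    (hmul : ∀ x ∈ s, ∀ y ∈ s, x * y ∈ s) (hstar : ∀ x ∈ s, star x ∈ s) :
    IsClosed (closedSpan s hmul hstar : Set E) :=
  isClosed_closure

/-! ### The algebras `B_{Γ⁺}` and `B_{Γ⁺} ⊗ A` -/

section Cone

set_option linter.unusedSectionVars false

variable (Γ : Type v) [AddCommGroup Γ] [LinearOrder Γ] [IsOrderedAddMonoid Γ]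

/-- The positive cone `Γ⁺ = {x : 0 ≤ x}` of a totally ordered abelian group. -/
abbrev PosCone : Type v := {x : Γ // 0 ≤ x}

/-- The C*-algebra `ℓ^∞(Γ⁺, A)` of bounded functions from `Γ⁺` to `A`. -/
abbrev LInf (A : Type u) [NonUnitalCStarAlgebra A] : Type (max u v) :=
  lp (fun _ : PosCone Γ => A) ∞

variable {Γ} {A : Type u} [NonUnitalCStarAlgebra A]

/-- The characteristic function `1_s ∈ ℓ^∞(Γ⁺)` of `{x : s ≤ x}`. -/
def charFn (s : PosCone Γ) : LInf Γ ℂ :=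
  ⟨fun x => if s ≤ x then 1 else 0, memℓp_infty ⟨1, by
    rintro _ ⟨x, rfl⟩
    dsimp only
    split_ifs <;> simp⟩⟩

theorem charFn_apply (s x : PosCone Γ) : charFn s x = if s ≤ x then 1 else 0 := rfl

theorem charFn_mul (s t : PosCone Γ) : charFn s * charFn t = charFn (max s t) := by
  ext x
  simp only [lp.infty_coeFn_mul, Pi.mul_apply, charFn_apply, max_le_iff]
  split_ifs <;> simp_all

theorem charFn_star (s : PosCone Γ) : star (charFn s) = charFn s := by
  ext x
  simp only [lp.star_apply, charFn_apply]
  split_ifs <;> simp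

variable (Γ) in
/-- `B_{Γ⁺}` as a subalgebra of `ℓ^∞(Γ⁺)`: the closed span of the functions `1_s`. -/
def BSub : NonUnitalStarSubalgebra ℂ (LInf Γ ℂ) :=
  closedSpan (Set.range charFn)
    (by rintro _ ⟨s, rfl⟩ _ ⟨t, rfl⟩; exact ⟨max s t, (charFn_mul s t).symm⟩)
    (by rintro _ ⟨s, rfl⟩; exact ⟨s, (charFn_star s).symm⟩)

theorem charFn_mem (s : PosCone Γ) : charFn s ∈ BSub Γ := mem_closedSpan_of_mem ⟨s, rfl⟩

instance : IsClosed (BSub Γ : Set (LInf Γ ℂ)) := isClosed_closedSpan _ _ _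

variable (Γ) in
/-- The commutative C*-algebra `B_{Γ⁺}`. -/
def BAlg : Type v := BSub Γ

instance : NonUnitalCommCStarAlgebra (BAlg Γ) :=
  inferInstanceAs (NonUnitalCommCStarAlgebra (BSub Γ))

/-- The inclusion of `B_{Γ⁺}` in `ℓ^∞(Γ⁺)`. -/
def BAlg.incl : BAlg Γ →⋆ₙₐ[ℂ] LInf Γ ℂ := NonUnitalStarSubalgebraClass.subtype (BSub Γ)

theorem BAlg.incl_injective : Function.Injective (BAlg.incl (Γ := Γ)) := Subtype.val_injective

/-- The element `1_s` of `B_{Γ⁺}`; `1_0` is the identity. -/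
def unitB (s : PosCone Γ) : BAlg Γ := ⟨charFn s, charFn_mem s⟩

theorem unitB_zero_mul (f : BAlg Γ) : unitB 0 * f = f := by
  refine BAlg.incl_injective (lp.ext (funext fun x => ?_))
  have hx : (0 : PosCone Γ) ≤ x := x.2
  change charFn 0 x * BAlg.incl f x = BAlg.incl f x
  rw [charFn_apply, if_pos hx, one_mul]

theorem unitB_star (s : PosCone Γ) : star (unitB s) = unitB s :=
  BAlg.incl_injective (charFn_star s)

/-- The elementary tensor `f ⊗ a` for `f ∈ ℓ^∞(Γ⁺)` and `a ∈ A`, as the function `x ↦ f(x) a`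
in `ℓ^∞(Γ⁺, A)`. -/
def elemTensor (f : LInf Γ ℂ) (a : A) : LInf Γ A :=
  ⟨fun x => f x • a, memℓp_infty ⟨‖f‖ * ‖a‖, by
    rintro _ ⟨x, rfl⟩
    dsimp only
    rw [norm_smul]
    exact mul_le_mul_of_nonneg_right (lp.norm_apply_le_norm ENNReal.top_ne_zero f x)
      (norm_nonneg a)⟩⟩

theorem elemTensor_apply (f : LInf Γ ℂ) (a : A) (x : PosCone Γ) :
    elemTensor f a x = f x • a := rfl

theorem elemTensor_mul (f g : LInf Γ ℂ) (a b : A) :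
    elemTensor f a * elemTensor g b = elemTensor (f * g) (a * b) := by
  ext x
  simp only [lp.infty_coeFn_mul, Pi.mul_apply, elemTensor_apply, smul_mul_smul_comm]

theorem elemTensor_star (f : LInf Γ ℂ) (a : A) :
    star (elemTensor f a) = elemTensor (star f) (star a) := by
  ext x
  simp only [lp.star_apply, elemTensor_apply, star_smul]

variable (Γ A) in
/-- The C*-algebra tensor product `B_{Γ⁺} ⊗ A`, as a subalgebra of `ℓ^∞(Γ⁺, A)`. Since `B_{Γ⁺}` is
a commutative C*-algebra, the algebraic tensor product `B_{Γ⁺} ⊙ A` carries exactly one C*-norm;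
since `B_{Γ⁺}` consists of functions on `Γ⁺`, this norm is the supremum norm of the functions
`x ↦ ∑ fᵢ(x) aᵢ`, and the completion is the closed span of the `f ⊗ a` in `ℓ^∞(Γ⁺, A)`. -/
def BTensorSub : NonUnitalStarSubalgebra ℂ (LInf Γ A) :=
  closedSpan {F | ∃ (f : BAlg Γ) (a : A), F = elemTensor (BAlg.incl f) a}
    (by
      rintro _ ⟨f, a, rfl⟩ _ ⟨g, b, rfl⟩
      exact ⟨f * g, a * b, by rw [map_mul, elemTensor_mul]⟩)
    (by
      rintro _ ⟨f, a, rfl⟩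
      exact ⟨star f, star a, by rw [map_star, elemTensor_star]⟩)

instance : IsClosed (BTensorSub Γ A : Set (LInf Γ A)) := isClosed_closedSpan _ _ _

variable (Γ A) in
/-- The C*-algebra `B_{Γ⁺} ⊗ A`. -/
def BTensor : Type (max u v) := BTensorSub Γ A

instance : NonUnitalCStarAlgebra (BTensor Γ A) :=
  inferInstanceAs (NonUnitalCStarAlgebra (BTensorSub Γ A))

/-- The inclusion of `B_{Γ⁺} ⊗ A` in `ℓ^∞(Γ⁺, A)`. -/
def BTensor.incl : BTensor Γ A →⋆ₙₐ[ℂ] LInf Γ A :=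
  NonUnitalStarSubalgebraClass.subtype (BTensorSub Γ A)

theorem BTensor.incl_injective : Function.Injective (BTensor.incl (Γ := Γ) (A := A)) :=
  Subtype.val_injective

theorem BTensor.ext {F G : BTensor Γ A} (h : ∀ x, BTensor.incl F x = BTensor.incl G x) : F = G :=
  BTensor.incl_injective (lp.ext (funext h))

/-- The elementary tensor `f ⊗ a` in `B_{Γ⁺} ⊗ A`. -/
def tmul (f : BAlg Γ) (a : A) : BTensor Γ A :=
  ⟨elemTensor (BAlg.incl f) a, mem_closedSpan_of_mem ⟨f, a, rfl⟩⟩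

theorem incl_tmul (f : BAlg Γ) (a : A) :
    BTensor.incl (tmul f a) = elemTensor (BAlg.incl f) a := rfl

theorem tmul_mul (f g : BAlg Γ) (a b : A) : tmul f a * tmul g b = tmul (f * g) (a * b) := by
  refine BTensor.incl_injective ?_
  rw [map_mul, incl_tmul, incl_tmul, incl_tmul, elemTensor_mul, map_mul]

theorem tmul_star (f : BAlg Γ) (a : A) : star (tmul f a) = tmul (star f) (star a) := by
  refine BTensor.incl_injective ?_
  rw [map_star, incl_tmul, incl_tmul, elemTensor_star, map_star]

variable (Γ A) in
/-- The elementary tensor as a bilinear map. -/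
def tmulBilin : BAlg Γ →ₗ[ℂ] A →ₗ[ℂ] BTensor Γ A :=
  LinearMap.mk₂ ℂ tmul
    (fun f g a => BTensor.ext fun x => by
      simp only [map_add, lp.coeFn_add, Pi.add_apply, incl_tmul, elemTensor_apply, add_smul])
    (fun c f a => BTensor.ext fun x => by
      simp only [map_smul, lp.coeFn_smul, Pi.smul_apply, incl_tmul, elemTensor_apply, smul_assoc])
    (fun f a b => BTensor.ext fun x => by
      simp only [map_add, lp.coeFn_add, Pi.add_apply, incl_tmul, elemTensor_apply, smul_add])
    (fun c f a => BTensor.ext fun x => by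
      simp only [map_smul, lp.coeFn_smul, Pi.smul_apply, incl_tmul, elemTensor_apply]
      exact smul_comm _ _ _)

theorem tmulBilin_apply (f : BAlg Γ) (a : A) : tmulBilin Γ A f a = tmul f a := rfl

variable (Γ A) in
/-- The canonical map of the algebraic tensor product into `B_{Γ⁺} ⊗ A`. -/
def ofAlgTensor : (BAlg Γ ⊗[ℂ] A) →ₗ[ℂ] BTensor Γ A := TensorProduct.lift (tmulBilin Γ A)

theorem ofAlgTensor_tmul (f : BAlg Γ) (a : A) : ofAlgTensor Γ A (f ⊗ₜ a) = tmul f a := rfl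

/-- The supremum norm of `B_{Γ⁺} ⊗ A` is a norm on the algebraic tensor product. -/
theorem ofAlgTensor_injective : Function.Injective (ofAlgTensor Γ A) := by
  classical
  set b := Module.Basis.ofVectorSpace ℂ A
  have key : ∀ (t : BAlg Γ ⊗[ℂ] A) (x : PosCone Γ) i,
      b.repr (BTensor.incl (ofAlgTensor Γ A t) x) i =
        BAlg.incl (TensorProduct.equivFinsuppOfBasisRight b t i) x := by
    intro t x i
    induction t with
    | zero => simp
    | tmul f a =>
      rw [ofAlgTensor_tmul, TensorProduct.equivFinsuppOfBasisRight_apply_tmul_apply, incl_tmul,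
        elemTensor_apply]
      simp [mul_comm]
    | add s t hs ht => simp [hs, ht]
  intro s t h
  refine (TensorProduct.equivFinsuppOfBasisRight b).injective ?_
  ext i : 1
  refine BAlg.incl_injective (lp.ext (funext fun x => ?_))
  rw [← key s x i, ← key t x i, h]

/-- The algebraic tensor product is dense in `B_{Γ⁺} ⊗ A`. -/
theorem ofAlgTensor_dense : DenseRange (ofAlgTensor Γ A) := by
  intro F
  have hF : BTensor.incl F ∈ closure (BTensor.incl '' Set.range (ofAlgTensor Γ A)) := by
    refine closure_mono ?_ F.2
    intro G hG
    refine Submodule.span_induction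
      (p := fun G _ => G ∈ BTensor.incl '' Set.range (ofAlgTensor Γ A)) ?_ ?_ ?_ ?_ hG
    · rintro _ ⟨f, a, rfl⟩
      exact ⟨_, ⟨f ⊗ₜ a, rfl⟩, rfl⟩
    · exact ⟨0, ⟨0, LinearMap.map_zero _⟩, map_zero _⟩
    · rintro _ _ _ _ ⟨_, ⟨s, rfl⟩, rfl⟩ ⟨_, ⟨t, rfl⟩, rfl⟩
      exact ⟨_, ⟨s + t, LinearMap.map_add _ s t⟩, map_add _ _ _⟩
    · rintro c _ _ ⟨_, ⟨s, rfl⟩, rfl⟩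
      exact ⟨_, ⟨c • s, LinearMap.map_smul _ c s⟩, map_smul _ _ _⟩
  exact closure_subtype.2 hF

/-- The homomorphism `a ↦ 1 ⊗ a` of `A` into `B_{Γ⁺} ⊗ A`. -/
def oneTensor : A →⋆ₙₐ[ℂ] BTensor Γ A where
  toFun a := tmul (unitB 0) a
  map_smul' c a := (tmulBilin Γ A (unitB 0)).map_smul c a
  map_zero' := (tmulBilin Γ A (unitB 0)).map_zero
  map_add' a b := (tmulBilin Γ A (unitB 0)).map_add a b
  map_mul' a b := by rw [tmul_mul, unitB_zero_mul]
  map_star' a := by rw [tmul_star, unitB_star]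

/-! ### The actions `τ` and `γ = τ ⊗ α⁻¹` -/

/-- For `x ∈ Γ⁺` and an endomorphism `φ` of `A`, the endomorphism of `ℓ^∞(Γ⁺, A)` that applies `φ`
and translates to the right by `x`:
`(shiftMap x φ F)(y) = φ (F (y - x))` if `x ≤ y`, and `0` otherwise. -/
def shiftMap (x : PosCone Γ) (φ : A →⋆ₙₐ[ℂ] A) : LInf Γ A →⋆ₙₐ[ℂ] LInf Γ A where
  toFun F := ⟨fun y => if h : x ≤ y then φ (F ⟨y.1 - x.1, sub_nonneg.2 h⟩) else 0,
    memℓp_infty ⟨‖F‖, by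
      rintro _ ⟨y, rfl⟩
      dsimp only
      split_ifs
      · exact (NonUnitalStarAlgHom.norm_apply_le φ _).trans
          (lp.norm_apply_le_norm ENNReal.top_ne_zero F _)
      · simp⟩⟩
  map_smul' c F := by
    ext y
    change (if h : x ≤ y then φ (c • F _) else 0) = c • (if h : x ≤ y then φ (F _) else 0)
    split_ifs <;> simp
  map_zero' := by
    ext y
    change (if h : x ≤ y then φ 0 else 0) = 0
    split_ifs <;> simp
  map_add' F G := by
    ext y
    change (if h : x ≤ y then φ (F _ + G _) else 0) =
      (if h : x ≤ y then φ (F _) else 0) + (if h : x ≤ y then φ (G _) else 0)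
    split_ifs <;> simp
  map_mul' F G := by
    ext y
    change (if h : x ≤ y then φ ((F * G : LInf Γ A) _) else 0) =
      (if h : x ≤ y then φ (F _) else 0) * (if h : x ≤ y then φ (G _) else 0)
    split_ifs <;> simp
  map_star' F := by
    ext y
    change (if h : x ≤ y then φ (star (F _)) else 0) = star (if h : x ≤ y then φ (F _) else 0)
    split_ifs
    · exact map_star φ _
    · simp

theorem shiftMap_apply (x : PosCone Γ) (φ : A →⋆ₙₐ[ℂ] A) (F : LInf Γ A) (y : PosCone Γ) :
    shiftMap x φ F y = if h : x ≤ y then φ (F ⟨y.1 - x.1, sub_nonneg.2 h⟩) else 0 := rfl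

theorem shiftMap_zero (F : LInf Γ A) : shiftMap 0 (NonUnitalStarAlgHom.id ℂ A) F = F := by
  ext y
  have hy : (0 : PosCone Γ) ≤ y := y.2
  rw [shiftMap_apply, dif_pos hy]
  change F ⟨y.1 - 0, _⟩ = F y
  exact congrArg F (Subtype.ext (sub_zero y.1))

theorem shiftMap_add (x y : PosCone Γ) (φ ψ : A →⋆ₙₐ[ℂ] A) (F : LInf Γ A) :
    shiftMap (x + y) (φ.comp ψ) F = shiftMap x φ (shiftMap y ψ F) := by
  ext z
  simp only [shiftMap_apply]
  have hiff : (x + y ≤ z) ↔ ∃ h : x ≤ z, y ≤ ⟨z.1 - x.1, sub_nonneg.2 h⟩ := by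
    constructor
    · intro h
      have h1 : x.1 + y.1 ≤ z.1 := h
      refine ⟨(le_add_of_nonneg_right y.2).trans h1, ?_⟩
      exact le_sub_iff_add_le'.2 h1
    · rintro ⟨_, h⟩
      exact le_sub_iff_add_le'.1 (show y.1 ≤ z.1 - x.1 from h)
  by_cases h : x + y ≤ z
  · obtain ⟨h1, h2⟩ := hiff.1 h
    rw [dif_pos h, dif_pos h1, dif_pos h2]
    change φ (ψ _) = φ (ψ _)
    exact congrArg (fun w => φ (ψ (F w))) (Subtype.ext (sub_add_eq_sub_sub z.1 x.1 y.1))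
  · rw [dif_neg h]
    by_cases h1 : x ≤ z
    · have h2 : ¬ y ≤ ⟨z.1 - x.1, sub_nonneg.2 h1⟩ := fun h2 => h (hiff.2 ⟨h1, h2⟩)
      rw [dif_pos h1, dif_neg h2, map_zero]
    · rw [dif_neg h1]

theorem shiftMap_elemTensor (x : PosCone Γ) (φ : A →⋆ₙₐ[ℂ] A) (f : LInf Γ ℂ) (a : A) :
    shiftMap x φ (elemTensor f a) =
      elemTensor (shiftMap x (NonUnitalStarAlgHom.id ℂ ℂ) f) (φ a) := by
  ext y
  simp only [shiftMap_apply, elemTensor_apply]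
  split_ifs <;> simp

theorem shiftMap_charFn (x s : PosCone Γ) :
    shiftMap x (NonUnitalStarAlgHom.id ℂ ℂ) (charFn s) = charFn (s + x) := by
  ext y
  simp only [shiftMap_apply, charFn_apply]
  have hiff : (s + x ≤ y) ↔ ∃ h : x ≤ y, s ≤ ⟨y.1 - x.1, sub_nonneg.2 h⟩ := by
    constructor
    · intro h
      have h1 : s.1 + x.1 ≤ y.1 := h
      exact ⟨(le_add_of_nonneg_left s.2).trans h1, le_sub_iff_add_le.2 h1⟩
    · rintro ⟨_, h⟩
      exact le_sub_iff_add_le.1 (show s.1 ≤ y.1 - x.1 from h)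
  by_cases h1 : x ≤ y
  · simp [h1, hiff]
  · simp [h1, hiff]

/-- The endomorphism `τ_x` of `B_{Γ⁺}`, given by translation on `ℓ^∞(Γ⁺)`. -/
def tauMap (x : PosCone Γ) : BAlg Γ →⋆ₙₐ[ℂ] BAlg Γ :=
  NonUnitalStarAlgHom.codRestrict ((shiftMap x (NonUnitalStarAlgHom.id ℂ ℂ)).comp BAlg.incl)
    (BSub Γ) fun f => map_mem_closedSpan (shiftMap x (NonUnitalStarAlgHom.id ℂ ℂ))
      (by rintro _ ⟨s, rfl⟩; exact ⟨s + x, (shiftMap_charFn x s).symm⟩) f.2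

theorem incl_tauMap (x : PosCone Γ) (f : BAlg Γ) :
    BAlg.incl (tauMap x f) = shiftMap x (NonUnitalStarAlgHom.id ℂ ℂ) (BAlg.incl f) := rfl

/-- `τ_x (1_s) = 1_{s + x}`. -/
theorem tauMap_unitB (x s : PosCone Γ) : tauMap x (unitB s) = unitB (s + x) :=
  BAlg.incl_injective (shiftMap_charFn x s)

/-- The endomorphism `τ_x ⊗ φ` of `B_{Γ⁺} ⊗ A`. -/
def tauTensor (x : PosCone Γ) (φ : A →⋆ₙₐ[ℂ] A) : BTensor Γ A →⋆ₙₐ[ℂ] BTensor Γ A :=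
  NonUnitalStarAlgHom.codRestrict ((shiftMap x φ).comp BTensor.incl)
    (BTensorSub Γ A) fun F => map_mem_closedSpan (shiftMap x φ)
      (by rintro _ ⟨f, a, rfl⟩; exact ⟨tauMap x f, φ a, shiftMap_elemTensor x φ _ a⟩) F.2

theorem incl_tauTensor (x : PosCone Γ) (φ : A →⋆ₙₐ[ℂ] A) (F : BTensor Γ A) :
    BTensor.incl (tauTensor x φ F) = shiftMap x φ (BTensor.incl F) := rfl

theorem tauTensor_tmul (x : PosCone Γ) (φ : A →⋆ₙₐ[ℂ] A) (f : BAlg Γ) (a : A) :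
    tauTensor x φ (tmul f a) = tmul (tauMap x f) (φ a) :=
  BTensor.incl_injective (shiftMap_elemTensor x φ _ a)

theorem tauTensor_zero : tauTensor 0 (NonUnitalStarAlgHom.id ℂ A) =
    NonUnitalStarAlgHom.id ℂ (BTensor Γ A) :=
  NonUnitalStarAlgHom.ext fun F => BTensor.incl_injective (shiftMap_zero (BTensor.incl F))

theorem tauTensor_add (x y : PosCone Γ) (φ ψ : A →⋆ₙₐ[ℂ] A) :
    tauTensor (x + y) (φ.comp ψ) = (tauTensor x φ).comp (tauTensor y ψ) :=
  NonUnitalStarAlgHom.ext fun F =>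
    BTensor.incl_injective (shiftMap_add x y φ ψ (BTensor.incl F))

/-- The action `γ` of `Γ⁺` on `B_{Γ⁺} ⊗ A` given by `γ_x = τ_x ⊗ α_x⁻¹`. -/
def gammaAction (α : Multiplicative (PosCone Γ) →* (A ≃⋆ₐ[ℂ] A)) :
    Multiplicative (PosCone Γ) →* (BTensor Γ A →⋆ₙₐ[ℂ] BTensor Γ A) where
  toFun x := tauTensor x.toAdd ((α x).symm : A →⋆ₙₐ[ℂ] A)
  map_one' := by
    have h : ((α 1).symm : A →⋆ₙₐ[ℂ] A) = NonUnitalStarAlgHom.id ℂ A := by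
      rw [map_one]; rfl
    rw [h]
    exact tauTensor_zero
  map_mul' x y := by
    have h : ((α (x * y)).symm : A →⋆ₙₐ[ℂ] A) =
        ((α x).symm : A →⋆ₙₐ[ℂ] A).comp ((α y).symm : A →⋆ₙₐ[ℂ] A) := by
      rw [mul_comm x y, map_mul]; rfl
    rw [h]
    exact tauTensor_add _ _ _ _

/-- `γ_x (f ⊗ a) = τ_x(f) ⊗ α_x⁻¹(a)`. -/
theorem gammaAction_tmul (α : Multiplicative (PosCone Γ) →* (A ≃⋆ₐ[ℂ] A)) (x : PosCone Γ)
    (f : BAlg Γ) (a : A) :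
    gammaAction α (.ofAdd x) (tmul f a) = tmul (tauMap x f) ((α (.ofAdd x)).symm a) :=
  tauTensor_tmul x _ f a

end Cone

end PisoCP

end

open PisoCP

/-!
Because `α` acts by automorphisms, the partial isometries of a covariant pair `(π, V)` of
`(A, Γ⁺, α)` are coisometries (`IsPisoCovariant.mul_star_self`), so `W = V^*` is an isometric
representation. Its range projections `V_s^* V_s` decrease in `s` and commute with `π(A)`, and a
chain of projections commuting with `π` satisfies `‖∑ V_s^* V_s π(a_s)‖ ≤ sup_x ‖∑_{s ≤ x} a_s‖`,
the norm of `∑ 1_s ⊗ a_s` (`IsPisoCovariant.norm_linearCombination_projElem_le`). Hence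
`1_s ⊗ a ↦ V_s^* V_s π(a)` extends to `B_{Γ⁺} ⊗ A`, and together with `W` it is an isometric
covariant pair for `γ` (`IsPisoCovariant.toIso`). Conversely an isometric covariant pair `(π, W)`
for `γ` gives the partial-isometric pair `(π(1 ⊗ ·), W^*)` (`IsIsoCovariant.toPiso`). The two
constructions are mutually inverse, so the two universal properties are the same; since `Γ` is
totally ordered, the span of the elements `V_s^* π(a) V_t` is closed under products, which matches
the two generation conditions.

What remains is that crossed products exist and are unique. For existence, the crossed product of
`(A, Γ⁺, α)` is generated by a family of covariant representations that realizes every C*-seminorm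
coming from a covariant representation (`exists_pisoCrossedProduct`); indexing by seminorms keeps
the family in the right universe. For uniqueness, universality is tested on a representation of
the multiplier algebra of the target (`IsPisoCrossedProduct.exists_equiv`). Such representations
come from the GNS construction (`exists_nondegenerateRep_norm_le`), and a homomorphism is built
from generators by a norm estimate (`exists_starAlgHom_of_norm_le`).
-/

set_option linter.unusedSectionVars false

/-! ### Approximate units -/

open Filter Topology in
theorem CStarAlgebra.exists_norm_mul_sub_lt {A : Type u} [NonUnitalCStarAlgebra A] (a : A)
    {ε : ℝ} (hε : 0 < ε) : ∃ e : A, ‖e * a - a‖ < ε := by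
  let _ := CStarAlgebra.spectralOrder A
  let _ := CStarAlgebra.spectralOrderedRing A
  have h := (CStarAlgebra.increasingApproximateUnit (A := A)).tendsto_mul_right a
  obtain ⟨e, he⟩ := (Metric.tendsto_nhds.1 h ε hε).exists
  exact ⟨e, by rwa [← dist_eq_norm]⟩

theorem CStarAlgebra.mem_closure_mul {A : Type u} [NonUnitalCStarAlgebra A] (a : A) :
    a ∈ closure (Set.range fun e : A => e * a) := by
  refine Metric.mem_closure_iff.2 fun ε hε => ?_
  obtain ⟨e, he⟩ := CStarAlgebra.exists_norm_mul_sub_lt a hε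
  exact ⟨e * a, ⟨e, rfl⟩, by rwa [dist_comm, dist_eq_norm]⟩

/-! ### Homomorphisms of C*-algebras given on generators -/

section Homs

variable {E : Type u} {F : Type v} [NonUnitalCStarAlgebra E] [NonUnitalCStarAlgebra F]

theorem NonUnitalStarAlgHom.continuous_of_cstar (φ : E →⋆ₙₐ[ℂ] F) : Continuous φ :=
  AddMonoidHomClass.continuous_of_bound φ 1 fun x => by
    simpa only [one_mul] using NonUnitalStarAlgHom.norm_apply_le φ x

theorem ContinuousLinearMap.eq_of_dense_span {E' F' : Type*} [NormedAddCommGroup E']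
    [NormedSpace ℂ E'] [NormedAddCommGroup F'] [NormedSpace ℂ F'] {s : Set E'}
    (hs : Dense (Submodule.span ℂ s : Set E')) {T T' : E' →L[ℂ] F'}
    (h : ∀ x ∈ s, T x = T' x) (x : E') : T x = T' x :=
  congrArg (fun T : E' →L[ℂ] F' => T x) (ContinuousLinearMap.ext_on hs h)

/-- A `*`-homomorphism of C*-algebras as a continuous linear map. -/
noncomputable def NonUnitalStarAlgHom.toCLM (φ : E →⋆ₙₐ[ℂ] F) : E →L[ℂ] F where
  toFun := φ
  map_add' := map_add φ
  map_smul' := map_smul φ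
  cont := φ.continuous_of_cstar

/-- A map between generators of C*-algebras that respects products and adjoints and does not
increase the norm of linear combinations extends to a homomorphism: the closed span of the pairs
`(f x, g x)` in `E × F` is a C*-algebra, and it is the graph of the extension because its first
projection is isometric with dense range. -/
theorem exists_starAlgHom_of_norm_le {X : Type w} (f : X → E) (g : X → F)
    (hmul : ∀ x y, ∃ z, f x * f y = f z ∧ g x * g y = g z)
    (hstar : ∀ x, ∃ z, star (f x) = f z ∧ star (g x) = g z)
    (hdense : Dense (Submodule.span ℂ (Set.range f) : Set E))
    (hnorm : ∀ c : X →₀ ℂ, ‖Finsupp.linearCombination ℂ g c‖ ≤ ‖Finsupp.linearCombination ℂ f c‖) :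
    ∃ φ : E →⋆ₙₐ[ℂ] F, ∀ x, φ (f x) = g x := by
  set s : Set (E × F) := Set.range fun x => (f x, g x) with hs
  have hmul' : ∀ x ∈ s, ∀ y ∈ s, x * y ∈ s := by
    rintro _ ⟨x, rfl⟩ _ ⟨y, rfl⟩
    obtain ⟨z, h1, h2⟩ := hmul x y
    exact ⟨z, Prod.ext h1.symm h2.symm⟩
  have hstar' : ∀ x ∈ s, star x ∈ s := by
    rintro _ ⟨x, rfl⟩
    obtain ⟨z, h1, h2⟩ := hstar x
    exact ⟨z, Prod.ext h1.symm h2.symm⟩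
  set R := closedSpan s hmul' hstar' with hR
  have hle : ∀ p ∈ R, ‖p.2‖ ≤ ‖p.1‖ := by
    intro p hp
    refine closure_minimal (t := {p : E × F | ‖p.2‖ ≤ ‖p.1‖}) ?_
      (isClosed_le (by fun_prop) (by fun_prop)) hp
    intro q hq
    obtain ⟨c, rfl⟩ := (Finsupp.mem_span_range_iff_exists_finsupp).1 hq
    have h1 : (c.sum fun i a => a • (f i, g i)).1 = Finsupp.linearCombination ℂ f c := by
      simp [Finsupp.linearCombination_apply, Finsupp.sum, Prod.fst_sum]
    have h2 : (c.sum fun i a => a • (f i, g i)).2 = Finsupp.linearCombination ℂ g c := by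
      simp [Finsupp.linearCombination_apply, Finsupp.sum, Prod.snd_sum]
    change ‖(c.sum fun i a => a • (f i, g i)).2‖ ≤ ‖(c.sum fun i a => a • (f i, g i)).1‖
    rw [h1, h2]
    exact hnorm c
  let p₁ : R →⋆ₙₐ[ℂ] E :=
    (NonUnitalStarAlgHom.fst ℂ E F).comp (NonUnitalStarSubalgebraClass.subtype R)
  let p₂ : R →⋆ₙₐ[ℂ] F :=
    (NonUnitalStarAlgHom.snd ℂ E F).comp (NonUnitalStarSubalgebraClass.subtype R)
  have hiso : Isometry p₁ := by
    refine AddMonoidHomClass.isometry_of_norm p₁ fun p => ?_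
    change ‖p.1.1‖ = max ‖p.1.1‖ ‖p.1.2‖
    rw [max_eq_left (hle p.1 p.2)]
  have hsurj : Function.Surjective p₁ := by
    have hcl : IsClosed (Set.range p₁) := hiso.isClosedEmbedding.isClosed_range
    have hsub : (Submodule.span ℂ (Set.range f) : Set E) ⊆ Set.range p₁ := by
      intro x hx
      refine Submodule.span_induction (p := fun x _ => x ∈ Set.range p₁) ?_ ?_ ?_ ?_ hx
      · rintro _ ⟨x, rfl⟩
        exact ⟨⟨(f x, g x), mem_closedSpan_of_mem ⟨x, rfl⟩⟩, rfl⟩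
      · exact ⟨0, map_zero _⟩
      · rintro _ _ _ _ ⟨a, rfl⟩ ⟨b, rfl⟩
        exact ⟨a + b, map_add _ _ _⟩
      · rintro r _ _ ⟨a, rfl⟩
        exact ⟨r • a, map_smul _ _ _⟩
    intro x
    have := closure_minimal hsub hcl (hdense x)
    exact this
  let e : R ≃⋆ₐ[ℂ] E := StarAlgEquiv.ofBijective p₁ ⟨hiso.injective, hsurj⟩
  refine ⟨p₂.comp (e.symm : E →⋆ₙₐ[ℂ] R), fun x => ?_⟩
  have hx : e ⟨(f x, g x), mem_closedSpan_of_mem ⟨x, rfl⟩⟩ = f x := rfl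
  change p₂ (e.symm (f x)) = g x
  rw [← hx, e.symm_apply_apply]
  rfl

end Homs

/-! ### Positive functionals -/

section States

variable {M : Type u} [CStarAlgebra M]

open Complex in
/-- A functional of norm at most one that maps `1` to `1` is real on self-adjoint elements, because
`|φ(x + it)|² ≤ ‖x‖² + t²` for all real `t`. -/
theorem CStarAlgebra.im_eq_zero_of_norm_le_one (φ : StrongDual ℂ M) (hφ : ‖φ‖ ≤ 1)
    (h1 : φ 1 = 1) {x : M} (hx : IsSelfAdjoint x) : (φ x).im = 0 := by
  have key : ∀ t : ℝ, 2 * t * (φ x).im ≤ ‖x‖ ^ 2 := by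
    intro t
    set y : M := x + (t * I : ℂ) • 1 with hy
    have hφy : φ y = φ x + t * I := by simp [hy, h1]
    have hyy : star y * y = x * x + ((t : ℂ) ^ 2) • 1 := by
      simp only [hy, star_add, hx.star_eq, star_smul, star_one, add_mul, mul_add, smul_mul_assoc,
        mul_smul_comm, one_mul, mul_one]
      have : star (t * I : ℂ) = -(t * I) := by simp
      have h3 : (t * I : ℂ) * -(t * I) = (t : ℂ) ^ 2 := by
        ring_nf
        simp
      rw [this, smul_add, smul_smul, h3]
      module
    have h1n : ‖(1 : M)‖ ≤ 1 := by
      rcases subsingleton_or_nontrivial M with h | h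
      · simp [Subsingleton.elim (1 : M) 0]
      · simp
    have hny : ‖y‖ ^ 2 ≤ ‖x‖ ^ 2 + t ^ 2 := by
      rw [sq, ← CStarRing.norm_star_mul_self, hyy]
      refine (norm_add_le _ _).trans (add_le_add ((norm_mul_le _ _).trans (sq ‖x‖).ge) ?_)
      rw [norm_smul]
      refine (mul_le_of_le_one_right (norm_nonneg _) h1n).trans ?_
      simp
    have hle : ‖φ y‖ ^ 2 ≤ ‖y‖ ^ 2 :=
      pow_le_pow_left₀ (norm_nonneg _) (φ.le_of_opNorm_le hφ y |>.trans (one_mul _).le) 2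
    rw [hφy, Complex.sq_norm, Complex.normSq_apply] at hle
    simp at hle
    nlinarith [sq_nonneg (φ x).re, sq_nonneg (φ x).im]
  by_contra hne
  have := key ((‖x‖ ^ 2 + 1) / (2 * (φ x).im))
  have h3 : 2 * ((‖x‖ ^ 2 + 1) / (2 * (φ x).im)) * (φ x).im = ‖x‖ ^ 2 + 1 := by
    field_simp
  linarith

open scoped ComplexOrder in
/-- Every positive element `x` of a unital C*-algebra has a contractive positive functional that
attains its norm at `x`. A norming functional of `1 + x` does this: since `‖1 + x‖ = 1 + ‖x‖`, it
must map `1` to `1` and `x` to `‖x‖`. -/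
theorem CStarAlgebra.exists_positive_functional [PartialOrder M] [StarOrderedRing M]
    {x : M} (hx : 0 ≤ x) :
    ∃ φ : M →ₚ[ℂ] ℂ, φ x = ‖x‖ ∧ ∀ y, ‖φ y‖ ≤ ‖y‖ := by
  rcases subsingleton_or_nontrivial M with h | h
  · exact ⟨0, by simp [Subsingleton.elim x 0], by simp⟩
  obtain ⟨φ, hφ, hφx⟩ := exists_dual_vector'' ℂ (1 + x)
  have hbound : ∀ y, ‖φ y‖ ≤ ‖y‖ := fun y => (φ.le_of_opNorm_le hφ y).trans (one_mul _).le
  have hnorm : 1 + ‖x‖ ≤ ‖1 + x‖ := by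
    have h1 : ‖x‖ ∈ spectrum ℝ x := CStarAlgebra.norm_mem_spectrum_of_nonneg hx
    have h2 : 1 + ‖x‖ ∈ spectrum ℝ (1 + x) := by
      have := spectrum.add_mem_add_iff (R := ℝ) (a := x) (r := ‖x‖) (s := 1)
      rw [add_comm 1 ‖x‖]
      simpa using this.2 h1
    exact (le_abs_self _).trans (spectrum.norm_le_norm_of_mem h2)
  have hre1 : (φ 1).re ≤ 1 :=
    (Complex.re_le_norm _).trans ((hbound 1).trans CStarRing.norm_one.le)
  have hrex : (φ x).re ≤ ‖x‖ := (Complex.re_le_norm _).trans (hbound x)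
  have hsum : (φ 1).re + (φ x).re = ‖1 + x‖ := by
    have := congrArg Complex.re hφx
    simpa using this
  have e1 : (φ 1).re = 1 := by linarith
  have ex : (φ x).re = ‖x‖ := by linarith
  have of_re : ∀ y : M, (φ y).re = ‖y‖ → φ y = ‖y‖ := by
    intro y hy
    have h1 := hbound y
    have h2 : (φ y).im = 0 := by
      have h3 : ‖φ y‖ ^ 2 ≤ ‖y‖ ^ 2 := pow_le_pow_left₀ (norm_nonneg _) h1 2
      rw [Complex.sq_norm, Complex.normSq_apply, hy] at h3
      nlinarith [sq_nonneg (φ y).im]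
    exact Complex.ext (by simpa using hy) (by simpa using h2)
  have h1 : φ 1 = 1 := by
    have := of_re 1 (by rw [e1, CStarRing.norm_one])
    simpa using this
  have hpos : ∀ y, 0 ≤ y → 0 ≤ φ y := by
    intro y hy
    have him := CStarAlgebra.im_eq_zero_of_norm_le_one φ hφ h1 (IsSelfAdjoint.of_nonneg hy)
    -- `0 ≤ ‖y‖ - y ≤ ‖y‖`, so `‖y‖ - φ y` is at most `‖y‖`
    have hle : ‖algebraMap ℝ M ‖y‖ - y‖ ≤ ‖y‖ := by
      refine (CStarAlgebra.norm_le_norm_of_nonneg_of_le ?_ ?_ :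
        _ ≤ ‖algebraMap ℝ M ‖y‖‖).trans (by simp [norm_algebraMap'])
      · exact sub_nonneg.2 (IsSelfAdjoint.of_nonneg hy).le_algebraMap_norm_self
      · exact sub_le_self _ hy
    have h2 := (Complex.re_le_norm _).trans ((hbound _).trans hle)
    have h3 : (φ (algebraMap ℝ M ‖y‖ - y)) = ‖y‖ - φ y := by
      rw [map_sub, Algebra.algebraMap_eq_smul_one, ← Complex.coe_smul, map_smul, h1]; simp
    rw [h3] at h2
    simp at h2
    exact Complex.nonneg_iff.2 ⟨h2, him.symm⟩
  exact ⟨PositiveLinearMap.mk₀ φ.toLinearMap hpos, of_re x ex, hbound⟩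

end States

/-! ### Multipliers -/

namespace DoubleCentralizer

variable {C : Type u} [NonUnitalCStarAlgebra C]

/-- A multiplier of a C*-algebra is determined by its action from the left. -/
theorem ext_fst {m n : 𝓜(ℂ, C)} (h : ∀ c, m.fst c = n.fst c) : m = n := by
  have h1 : (m - n).fst = 0 := ContinuousLinearMap.ext fun c => by
    rw [sub_fst, sub_apply, h, sub_self, zero_apply]
  have h2 := norm_fst (m - n)
  rw [h1, norm_zero] at h2
  exact sub_eq_zero.1 (norm_eq_zero.1 h2.symm)

theorem fst_mul (m : 𝓜(ℂ, C)) (c d : C) : m.fst (c * d) = m.fst c * d := by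
  refine (CStarRing.star_mul_self_eq_zero_iff _ |>.1 ?_ |> sub_eq_zero.1).symm
  rw [mul_sub, ← mul_assoc, ← m.central, ← m.central, mul_assoc, sub_self]

theorem coe_fst_apply (m : 𝓜(ℂ, C)) (c : C) : ((m.fst c : C) : 𝓜(ℂ, C)) = m * (c : 𝓜(ℂ, C)) :=
  ext_fst fun d => (fst_mul m c d).symm

theorem coe_snd_apply (m : 𝓜(ℂ, C)) (c : C) : ((m.snd c : C) : 𝓜(ℂ, C)) = (c : 𝓜(ℂ, C)) * m :=
  ext_fst fun d => m.central c d

theorem coe_injective : Function.Injective (fun c : C => (c : 𝓜(ℂ, C))) := by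
  intro c d h
  have h1 : ∀ b, c * b = d * b := fun b => congrArg (fun m : 𝓜(ℂ, C) => m.fst b) h
  refine CStarRing.mul_star_self_eq_zero_iff _ |>.1 ?_ |> sub_eq_zero.1
  rw [sub_mul, h1, sub_self]

theorem norm_coeHom (c : C) : ‖coeHom (𝕜 := ℂ) c‖ = ‖c‖ :=
  NonUnitalStarAlgHom.norm_map (coeHom (𝕜 := ℂ) (A := C)) coe_injective c

end DoubleCentralizer

/-! ### Nondegenerate representations and homomorphisms -/

section Nondegenerate

variable {D : Type v} [NonUnitalCStarAlgebra D] {C : Type u} [NonUnitalCStarAlgebra C]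
  {H : Type w} [NormedAddCommGroup H] [InnerProductSpace ℂ H] [CompleteSpace H]

/-- A family of elements of a ring is separating if no nonzero element is annihilated by
left multiplication by all its members. -/
def Separating {ι : Type*} {M : Type*} [Ring M] (π : ι → M) : Prop :=
  ∀ X : M, (∀ a, π a * X = 0) → X = 0

theorem Separating.eq {ι M : Type*} [Ring M] {π : ι → M} (h : Separating π)
    {X Y : M} (hXY : ∀ a, π a * X = π a * Y) : X = Y :=
  sub_eq_zero.1 (h _ fun a => by rw [mul_sub, hXY, sub_self])

theorem PisoCP.NondegenerateRep.separating {π : D →⋆ₙₐ[ℂ] (H →L[ℂ] H)} (h : NondegenerateRep π) :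
    Separating π := by
  intro X hX
  refine star_eq_zero.1 (ContinuousLinearMap.ext fun y => ?_)
  refine ContinuousLinearMap.eq_of_dense_span h (T := star X) (T' := 0) ?_ y
  rintro _ ⟨a, k, rfl⟩
  have h1 := congrArg star (hX (star a))
  rw [star_mul, ← map_star, star_star, star_zero] at h1
  exact congrArg (fun T : H →L[ℂ] H => T k) h1

theorem PisoCP.NondegenerateHom.separating {i : D →⋆ₙₐ[ℂ] C} (h : NondegenerateHom i) :
    Separating ((DoubleCentralizer.coeHom (𝕜 := ℂ)).comp i) := by
  intro X hX
  refine star_eq_zero.1 (DoubleCentralizer.ext_fst fun y => ?_)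
  refine ContinuousLinearMap.eq_of_dense_span h (T := (star X).fst) (T' := 0) ?_ y
  rintro _ ⟨a, k, rfl⟩
  have h1 := congrArg star (hX (star a))
  rw [star_mul, ← map_star, star_star, star_zero] at h1
  exact congrArg (fun T : 𝓜(ℂ, C) => T.fst k) h1

/-- The canonical extension of a nondegenerate representation to multipliers preserves adjoints. -/
theorem PisoCP.ExtensionMaps.star {ρ : C →⋆ₙₐ[ℂ] (H →L[ℂ] H)} (hρ : NondegenerateRep ρ)
    {m : 𝓜(ℂ, C)} {T : H →L[ℂ] H} (h : ExtensionMaps ρ m T) :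
    ExtensionMaps ρ (star m) (star T) := by
  intro b
  refine hρ.separating.eq fun c => ?_
  have h1 := congrArg Star.star (h (Star.star c))
  rw [star_mul, ← map_star, ← map_star, star_star] at h1
  rw [← mul_assoc, h1, ← map_mul, ← map_mul]
  congr 1
  rw [DoubleCentralizer.star_fst]
  have h2 := m.central (Star.star b) (Star.star c)
  have h3 := congrArg Star.star h2
  rw [star_mul, star_mul, star_star, star_star] at h3
  exact h3.symm

theorem PisoCP.ExtensionMaps.mul_eq {ρ : C →⋆ₙₐ[ℂ] (H →L[ℂ] H)} (hρ : NondegenerateRep ρ)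
    {m : 𝓜(ℂ, C)} {T : H →L[ℂ] H} (h : ExtensionMaps ρ m T) (b : C) :
    ρ b * T = ρ (m.snd b) := by
  have h1 := congrArg Star.star (h.star hρ (Star.star b))
  rwa [star_mul, ← map_star, ← map_star, star_star, star_star, DoubleCentralizer.star_fst,
    star_star, star_star] at h1

theorem Dense.of_span_subset_closure {E : Type*} [NormedAddCommGroup E] [NormedSpace ℂ E]
    {s t : Set E} (hs : Dense (Submodule.span ℂ s : Set E))
    (h : ∀ x ∈ s, x ∈ closure (Submodule.span ℂ t : Set E)) :
    Dense (Submodule.span ℂ t : Set E) := by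
  have h1 : Submodule.span ℂ s ≤ (Submodule.span ℂ t).topologicalClosure :=
    Submodule.span_le.2 h
  exact dense_closure.1 (hs.mono h1)

theorem PisoCP.NondegenerateRep.comp {π : C →⋆ₙₐ[ℂ] (H →L[ℂ] H)} (h : NondegenerateRep π)
    {i : D →⋆ₙₐ[ℂ] C}
    (hi : NondegenerateHom i) : NondegenerateRep (π.comp i) := by
  refine Dense.of_span_subset_closure h ?_
  rintro _ ⟨c, k, rfl⟩
  refine map_mem_closure (f := fun c => π c k) ?_ (hi c) fun b hb => ?_
  · exact ((ContinuousLinearMap.apply ℂ H k).comp π.toCLM).continuous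
  · refine Submodule.span_induction (p := fun b _ => π b k ∈ Submodule.span ℂ
      {k : H | ∃ a h, k = π.comp i a h}) ?_ ?_ ?_ ?_ hb
    · rintro _ ⟨a, b, rfl⟩
      refine Submodule.subset_span ⟨a, π b k, ?_⟩
      rw [map_mul]
      rfl
    · simp
    · intro x y _ _ h1 h2
      rw [map_add]
      exact add_mem h1 h2
    · intro r x _ h1
      rw [map_smul]
      exact Submodule.smul_mem _ _ h1

theorem PisoCP.NondegenerateHom.comp {D' : Type*} [NonUnitalCStarAlgebra D']
    {j : C →⋆ₙₐ[ℂ] D'} (h : NondegenerateHom j) {i : D →⋆ₙₐ[ℂ] C}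
    (hi : NondegenerateHom i) : NondegenerateHom (j.comp i) := by
  refine Dense.of_span_subset_closure h ?_
  rintro _ ⟨c, k, rfl⟩
  refine map_mem_closure (f := fun c => j c * k) ?_ (hi c) fun b hb => ?_
  · exact j.continuous_of_cstar.mul continuous_const
  · refine Submodule.span_induction (p := fun b _ => j b * k ∈ Submodule.span ℂ
      {c : D' | ∃ a b, c = j.comp i a * b}) ?_ ?_ ?_ ?_ hb
    · rintro _ ⟨a, b, rfl⟩
      refine Submodule.subset_span ⟨a, j b * k, ?_⟩
      rw [map_mul, mul_assoc]
      rfl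
    · simp
    · intro x y _ _ h1 h2
      rw [map_add, add_mul]
      exact add_mem h1 h2
    · intro r x _ h1
      rw [map_smul, smul_mul_assoc]
      exact Submodule.smul_mem _ _ h1

end Nondegenerate

/-! ### Representations of multiplier algebras -/

section GelfandNaimark

open scoped ComplexOrder

variable {C : Type u} [NonUnitalCStarAlgebra C]

/-- The form of the Gelfand–Naimark theorem used here: for each `c` there is a representation of
`M(C)`, nondegenerate on `C`, that does not decrease the norm of `c`. It is the GNS representation
of `m ↦ φ(c m c^*)`, where the positive functional `φ` of `M(C)` attains its norm at `(c c^*)²`;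
compressing by `c ∈ C` is what makes the representation nondegenerate on `C`. -/
theorem exists_nondegenerateRep_norm_le (c : C) :
    ∃ (H : Type u) (_ : NormedAddCommGroup H) (_ : InnerProductSpace ℂ H) (_ : CompleteSpace H)
      (ρ : 𝓜(ℂ, C) →⋆ₙₐ[ℂ] (H →L[ℂ] H)),
      NondegenerateRep (ρ.comp (DoubleCentralizer.coeHom (𝕜 := ℂ))) ∧
        ‖c‖ ≤ ‖ρ (DoubleCentralizer.coeHom (𝕜 := ℂ) c)‖ := by
  let _ := CStarAlgebra.spectralOrder 𝓜(ℂ, C)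
  let _ := CStarAlgebra.spectralOrderedRing 𝓜(ℂ, C)
  let ι : C →⋆ₙₐ[ℂ] 𝓜(ℂ, C) := DoubleCentralizer.coeHom (𝕜 := ℂ)
  have hι : ∀ c, ‖ι c‖ = ‖c‖ := DoubleCentralizer.norm_coeHom
  set a : 𝓜(ℂ, C) := ι c with ha
  obtain ⟨φ, hφx, hφ⟩ := CStarAlgebra.exists_positive_functional
    (star_mul_self_nonneg (a * star a))
  have hnx : ‖star (a * star a) * (a * star a)‖ = ‖c‖ ^ 4 := by
    rw [CStarRing.norm_star_mul_self, CStarRing.norm_self_mul_star, hι]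
    ring
  let f : 𝓜(ℂ, C) →ₚ[ℂ] ℂ := PositiveLinearMap.mk₀
    (φ.toLinearMap ∘ₗ LinearMap.mulLeft ℂ a ∘ₗ LinearMap.mulRight ℂ (star a)) fun m hm => by
      change 0 ≤ φ (a * (m * star a))
      rw [← mul_assoc]
      exact φ.map_nonneg (star_right_conjugate_nonneg hm a)
  have hf : ∀ m, f m = φ (a * (m * star a)) := fun m => rfl
  have hnorm : ∀ m : 𝓜(ℂ, C), ‖f.toPreGNS m‖ ^ 2 ≤ ‖m * star a‖ ^ 2 := by
    intro m
    have h1 := f.preGNS_norm_sq (f.toPreGNS m)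
    rw [f.ofPreGNS_toPreGNS, hf] at h1
    have h2 : a * (star m * m * star a) = star (m * star a) * (m * star a) := by
      rw [star_mul, star_star]
      noncomm_ring
    have h3 := hφ (a * (star m * m * star a))
    rw [← h1, h2, CStarRing.norm_star_mul_self] at h3
    simpa [sq] using h3
  refine ⟨f.GNS, inferInstance, inferInstance, inferInstance, f.gnsNonUnitalStarAlgHom, ?_, ?_⟩
  -- the class of `m` is the limit of its images under `ρ(e)`, for `e (m c^*)` close to `m c^*`
  · intro h
    refine closure_minimal ?_ isClosed_closure
      (UniformSpace.Completion.denseRange_coe (α := f.PreGNS) h)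
    rintro _ ⟨p, rfl⟩
    obtain ⟨m, rfl⟩ := f.toPreGNS.surjective p
    refine Metric.mem_closure_iff.2 fun ε hε => ?_
    obtain ⟨e, he⟩ := CStarAlgebra.exists_norm_mul_sub_lt (m.fst (star c)) hε
    refine ⟨f.gnsNonUnitalStarAlgHom (ι e) (f.toPreGNS m),
      Submodule.subset_span ⟨e, _, rfl⟩, ?_⟩
    rw [f.gnsNonUnitalStarAlgHom_apply_coe, dist_comm, UniformSpace.Completion.dist_eq,
      dist_eq_norm]
    have h1 : f.leftMulMapPreGNS (ι e) (f.toPreGNS m) - f.toPreGNS m =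
        f.toPreGNS (ι e * m - m) := rfl
    rw [h1]
    have h2 : (ι e * m - m) * star a = ι (e * m.fst (star c) - m.fst (star c)) := by
      have h3 : ι (m.fst (star c)) = m * star a := by
        rw [ha, ← map_star]
        exact DoubleCentralizer.coe_fst_apply m (star c)
      rw [map_sub, map_mul, h3, sub_mul, mul_assoc]
    have h4 := hnorm (ι e * m - m)
    rw [h2, hι] at h4
    exact lt_of_le_of_lt
      ((pow_le_pow_iff_left₀ (norm_nonneg _) (norm_nonneg _) two_ne_zero).1 h4) he
  -- the class `v` of `1` has `‖v‖² = φ(c c^*) ≤ ‖c‖²` and `‖ρ(c) v‖² = φ((c c^*)²) = ‖c‖⁴`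
  · rcases eq_or_ne c 0 with rfl | hc
    · rw [norm_zero]
      exact norm_nonneg _
    have hc' : 0 < ‖c‖ := norm_pos_iff.2 hc
    set T := f.gnsNonUnitalStarAlgHom a
    let v : f.GNS := (f.toPreGNS 1 : f.PreGNS)
    have hv : ‖v‖ ^ 2 ≤ ‖c‖ ^ 2 := by
      have := hnorm 1
      rw [one_mul, norm_star, hι] at this
      simpa [v] using this
    have hTv : ‖T v‖ ^ 2 = ‖c‖ ^ 4 := by
      have h1 : T v = (f.toPreGNS a : f.PreGNS) := by
        rw [f.gnsNonUnitalStarAlgHom_apply_coe]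
        congr 1
      have h2 := f.preGNS_norm_sq (f.toPreGNS a)
      rw [f.ofPreGNS_toPreGNS, hf] at h2
      have h3 : a * (star a * a * star a) = star (a * star a) * (a * star a) := by
        rw [star_mul, star_star]
        noncomm_ring
      rw [h3, hφx, hnx] at h2
      rw [h1, UniformSpace.Completion.norm_coe]
      exact_mod_cast h2
    have h5 : ‖T v‖ ^ 2 ≤ ‖T‖ ^ 2 * ‖c‖ ^ 2 := by
      calc ‖T v‖ ^ 2 ≤ (‖T‖ * ‖v‖) ^ 2 := pow_le_pow_left₀ (norm_nonneg _) (T.le_opNorm v) 2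
        _ = ‖T‖ ^ 2 * ‖v‖ ^ 2 := mul_pow _ _ _
        _ ≤ _ := mul_le_mul_of_nonneg_left hv (sq_nonneg _)
    rw [hTv] at h5
    have h6 : ‖c‖ ^ 2 ≤ ‖T‖ ^ 2 := by
      refine le_of_mul_le_mul_right ?_ (pow_pos hc' 2)
      calc _ = ‖c‖ ^ 4 := by ring
        _ ≤ _ := h5
    exact (pow_le_pow_iff_left₀ (norm_nonneg _) (norm_nonneg _) two_ne_zero).1 h6

end GelfandNaimark

/-! ### Subtraction in the positive cone -/

section Cone

variable {Γ : Type v} [AddCommGroup Γ] [LinearOrder Γ] [IsOrderedAddMonoid Γ]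

/-- Truncated subtraction in the positive cone. -/
def PisoCP.PosCone.tsub (t s : PosCone Γ) : PosCone Γ := ⟨max (t.1 - s.1) 0, le_max_right _ _⟩

theorem PisoCP.PosCone.tsub_add {s t : PosCone Γ} (h : s ≤ t) : PosCone.tsub t s + s = t := by
  have h1 : (0 : Γ) ≤ t.1 - s.1 := sub_nonneg.2 h
  refine Subtype.ext ?_
  change max (t.1 - s.1) 0 + s.1 = t.1
  rw [max_eq_left h1, sub_add_cancel]

end Cone

/-! ### Partial-isometric covariant pairs of an action by automorphisms -/

section PisoPairs

variable {Γ : Type v} [AddCommGroup Γ] [LinearOrder Γ] [IsOrderedAddMonoid Γ]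
  {A : Type u} [NonUnitalCStarAlgebra A] (α : Multiplicative (PosCone Γ) →* (A ≃⋆ₐ[ℂ] A))

variable {α}
variable {M : Type w} [Ring M] [StarRing M] [Algebra ℂ M] {π : A →⋆ₙₐ[ℂ] M} {V : PosCone Γ → M}

namespace PisoCP.IsPisoCovariant

theorem map_act (h : IsPisoCovariant (endAction α) π V) (s : PosCone Γ) (a : A) :
    π (α (.ofAdd s) a) = V s * π a * star (V s) := h.covariant s a

/-- Since `α_s` is surjective, `π(a) V_s V_s^* = π(a)` for all `a`: the `V_s` are coisometries. -/
theorem mul_star_self (h : IsPisoCovariant (endAction α) π V) (hπ : Separating π)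
    (s : PosCone Γ) : V s * star (V s) = 1 := by
  refine hπ.eq fun a => ?_
  have h1 : star (V s) * (V s * star (V s)) = star (V s) := by
    have := congrArg star (h.isRep.partialIsometry s)
    simpa [mul_assoc] using this
  obtain ⟨b, rfl⟩ := EquivLike.surjective (α (.ofAdd s)) a
  rw [h.map_act, mul_one, mul_assoc _ (star (V s)), h1]

theorem map_zero (h : IsPisoCovariant (endAction α) π V) (hπ : Separating π) : V 0 = 1 := by
  have h1 := h.mul_star_self hπ 0
  have h2 : V 0 * V 0 = V 0 := by rw [← h.isRep.map_add, add_zero]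
  calc V 0 = V 0 * (V 0 * star (V 0)) := by rw [h1, mul_one]
    _ = 1 := by rw [← mul_assoc, h2, h1]

theorem mul_map (h : IsPisoCovariant (endAction α) π V) (s : PosCone Γ) (a : A) :
    V s * π a = π (α (.ofAdd s) a) * V s := by
  rw [h.map_act, mul_assoc _ (star (V s)), mul_assoc, ← h.commute, ← mul_assoc, ← mul_assoc,
    h.isRep.partialIsometry]

theorem map_mul_star (h : IsPisoCovariant (endAction α) π V) (s : PosCone Γ) (a : A) :
    π a * star (V s) = star (V s) * π (α (.ofAdd s) a) := by
  have := congrArg star (h.mul_map s (star a))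
  simpa [← map_star] using this

theorem star_add (h : IsPisoCovariant (endAction α) π V) (s t : PosCone Γ) :
    star (V (s + t)) = star (V s) * star (V t) := by
  rw [add_comm, h.isRep.map_add, star_mul]

theorem mul_star_of_le (h : IsPisoCovariant (endAction α) π V) (hπ : Separating π)
    {s t : PosCone Γ} (hst : s ≤ t) : V t * star (V s) = V (PosCone.tsub t s) := by
  conv_lhs => rw [← PosCone.tsub_add hst, h.isRep.map_add, mul_assoc, h.mul_star_self hπ, mul_one]

theorem mul_star_of_ge (h : IsPisoCovariant (endAction α) π V) (hπ : Separating π)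
    {s t : PosCone Γ} (hst : s ≤ t) : V s * star (V t) = star (V (PosCone.tsub t s)) := by
  rw [← h.mul_star_of_le hπ hst, star_mul, star_star]

/-- The initial projections `V_s^* V_s` decrease in `s`. -/
theorem initialProj_mul (h : IsPisoCovariant (endAction α) π V) (hπ : Separating π)
    {s t : PosCone Γ} (hst : s ≤ t) :
    star (V s) * V s * (star (V t) * V t) = star (V t) * V t := by
  have h1 : star (V s) * star (V (PosCone.tsub t s)) = star (V t) := by
    rw [← h.star_add, add_comm, PosCone.tsub_add hst]
  calc _ = star (V s) * (V s * star (V t)) * V t := by simp only [mul_assoc]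
    _ = _ := by rw [h.mul_star_of_ge hπ hst, h1]

theorem initialProj_mul' (h : IsPisoCovariant (endAction α) π V) (hπ : Separating π)
    {s t : PosCone Γ} (hst : s ≤ t) :
    star (V t) * V t * (star (V s) * V s) = star (V t) * V t := by
  have := congrArg star (h.initialProj_mul hπ hst)
  simpa using this

end PisoCP.IsPisoCovariant

variable (Γ A) in
/-- The index set of the spanning elements `V_s^* π(a) V_t` of a partial-isometric crossed
product. -/
abbrev PisoIndex := PosCone Γ × A × PosCone Γ

/-- The spanning element `V_s^* π(a) V_t` of the algebra generated by a covariant pair. -/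
def pisoElem {M : Type w} [Mul M] [Star M] (π : A → M) (V : PosCone Γ → M)
    (x : PisoIndex Γ A) : M :=
  star (V x.1) * π x.2.1 * V x.2.2

namespace PisoIndex

open PosCone

/-- The index of the adjoint of a spanning element. -/
def adj (x : PisoIndex Γ A) : PisoIndex Γ A := (x.2.2, star x.2.1, x.1)

variable (α) in
/-- The index of the product of two spanning elements. -/
def mul (x y : PisoIndex Γ A) : PisoIndex Γ A :=
  if y.1 ≤ x.2.2 then
    (x.1, x.2.1 * α (.ofAdd (tsub x.2.2 y.1)) y.2.1, tsub x.2.2 y.1 + y.2.2)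
  else
    (x.1 + tsub y.1 x.2.2, α (.ofAdd (tsub y.1 x.2.2)) x.2.1 * y.2.1, y.2.2)

variable (α) in
/-- The index of the product of `V_s` and a spanning element. -/
def lmul (s : PosCone Γ) (x : PisoIndex Γ A) : PisoIndex Γ A :=
  if x.1 ≤ s then (0, α (.ofAdd (tsub s x.1)) x.2.1, tsub s x.1 + x.2.2)
  else (tsub x.1 s, x.2)

/-- The index of the product of `V_s^*` and a spanning element. -/
def slmul (s : PosCone Γ) (x : PisoIndex Γ A) : PisoIndex Γ A := (s + x.1, x.2)

end PisoIndex

namespace PisoCP.IsPisoCovariant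

theorem star_pisoElem (x : PisoIndex Γ A) : star (pisoElem π V x) = pisoElem π V x.adj := by
  simp [pisoElem, PisoIndex.adj, ← map_star, mul_assoc]

theorem pisoElem_mul (h : IsPisoCovariant (endAction α) π V) (hπ : Separating π)
    (x y : PisoIndex Γ A) :
    pisoElem π V x * pisoElem π V y = pisoElem π V (x.mul α y) := by
  obtain ⟨s, a, t⟩ := x
  obtain ⟨u, b, w⟩ := y
  have h1 : pisoElem π V (s, a, t) * pisoElem π V (u, b, w) =
      star (V s) * (π a * (V t * star (V u)) * π b) * V w := by
    simp only [pisoElem, mul_assoc]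
  rw [h1, PisoIndex.mul]
  dsimp only
  split_ifs with hut
  · rw [h.mul_star_of_le hπ hut, mul_assoc (π a), h.mul_map, pisoElem, h.isRep.map_add]
    simp only [map_mul, mul_assoc]
  · rw [h.mul_star_of_ge hπ (not_le.1 hut).le, h.map_mul_star, pisoElem, h.star_add]
    simp only [map_mul, mul_assoc]

theorem mul_pisoElem (h : IsPisoCovariant (endAction α) π V) (hπ : Separating π)
    (s : PosCone Γ) (x : PisoIndex Γ A) :
    V s * pisoElem π V x = pisoElem π V (x.lmul α s) := by
  obtain ⟨u, b, w⟩ := x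
  have h1 : V s * pisoElem π V (u, b, w) = (V s * star (V u)) * π b * V w := by
    simp only [pisoElem, mul_assoc]
  rw [h1, PisoIndex.lmul]
  dsimp only
  split_ifs with hus
  · rw [h.mul_star_of_le hπ hus, h.mul_map, pisoElem, h.isRep.map_add, h.map_zero hπ]
    simp only [star_one, one_mul, mul_assoc]
  · rw [h.mul_star_of_ge hπ (not_le.1 hus).le, pisoElem]

theorem star_mul_pisoElem (h : IsPisoCovariant (endAction α) π V)
    (s : PosCone Γ) (x : PisoIndex Γ A) :
    star (V s) * pisoElem π V x = pisoElem π V (x.slmul s) := by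
  rw [pisoElem, pisoElem, PisoIndex.slmul, h.star_add]
  simp only [mul_assoc]

theorem pisoElem_zero_zero (h : IsPisoCovariant (endAction α) π V) (hπ : Separating π)
    (a : A) : pisoElem π V (0, a, 0) = π a := by
  simp [pisoElem, h.map_zero hπ]

end PisoCP.IsPisoCovariant

end PisoPairs

/-! ### Isometric covariant pairs of `(B_{Γ⁺} ⊗ A, Γ⁺, γ)` -/

section IsoPairs

variable {Γ : Type v} [AddCommGroup Γ] [LinearOrder Γ] [IsOrderedAddMonoid Γ]
  {A : Type u} [NonUnitalCStarAlgebra A] {α : Multiplicative (PosCone Γ) →* (A ≃⋆ₐ[ℂ] A)}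
  {M : Type w} [Ring M] [StarRing M] [Algebra ℂ M] {π : BTensor Γ A →⋆ₙₐ[ℂ] M}
  {W : PosCone Γ → M}

theorem oneTensor_apply (a : A) : oneTensor (Γ := Γ) a = tmul (unitB 0) a := rfl

theorem gammaAction_oneTensor (s : PosCone Γ) (a : A) :
    gammaAction α (.ofAdd s) (oneTensor (α (.ofAdd s) a)) = tmul (unitB s) a := by
  rw [oneTensor_apply, gammaAction_tmul, tauMap_unitB, zero_add, StarAlgEquiv.symm_apply_apply]

theorem incl_oneTensor (a : A) (x : PosCone Γ) : BTensor.incl (oneTensor (Γ := Γ) a) x = a := by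
  have hx : (0 : PosCone Γ) ≤ x := x.2
  rw [oneTensor_apply, incl_tmul, elemTensor_apply]
  change charFn 0 x • a = a
  rw [charFn_apply, if_pos hx, one_smul]

theorem gammaAction_mul_oneTensor (s : PosCone Γ) (F : BTensor Γ A) (a : A) :
    gammaAction α (.ofAdd s) F * oneTensor a =
      gammaAction α (.ofAdd s) (F * oneTensor (α (.ofAdd s) a)) := by
  refine BTensor.ext fun x => ?_
  rw [map_mul, lp.infty_coeFn_mul, Pi.mul_apply, incl_oneTensor]
  change shiftMap s _ (BTensor.incl F) x * a = shiftMap s _ (BTensor.incl (F * _)) x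
  rw [shiftMap_apply, shiftMap_apply]
  split_ifs with h
  · rw [map_mul, lp.infty_coeFn_mul, Pi.mul_apply, incl_oneTensor, map_mul]
    congr 1
    exact ((α (.ofAdd s)).symm_apply_apply a).symm
  · rw [zero_mul]

namespace PisoCP.IsIsoCovariant

/-- Compressing by `W_s^*` undoes `γ_s`. This is checked after multiplication by `π(F)`, because
`γ_s(F) (1 ⊗ a) = γ_s(F (1 ⊗ α_s a))`. -/
theorem star_mul_oneTensor (h : IsIsoCovariant (gammaAction α) π W) (hπ : Separating π)
    (s : PosCone Γ) (a : A) :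
    star (W s) * π (oneTensor a) = π (oneTensor (α (.ofAdd s) a)) * star (W s) := by
  have h1 : ∀ F, π F * star (W s) = star (W s) * π (gammaAction α (.ofAdd s) F) := fun F => by
    rw [h.covariant, ← mul_assoc, ← mul_assoc, h.isRep.isometry, one_mul]
  refine hπ.eq fun F => ?_
  rw [← mul_assoc, h1, mul_assoc, ← map_mul, gammaAction_mul_oneTensor, ← h1, map_mul, mul_assoc]

theorem rangeProj_mul (h : IsIsoCovariant (gammaAction α) π W) (hπ : Separating π)
    (s : PosCone Γ) (a : A) :
    W s * star (W s) * π (oneTensor a) = π (tmul (unitB s) a) := by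
  rw [mul_assoc, h.star_mul_oneTensor hπ, ← mul_assoc, ← h.covariant, gammaAction_oneTensor]

theorem mul_rangeProj (h : IsIsoCovariant (gammaAction α) π W) (hπ : Separating π)
    (s : PosCone Γ) (a : A) :
    π (oneTensor a) * (W s * star (W s)) = π (tmul (unitB s) a) := by
  have := congrArg star (h.rangeProj_mul hπ s (star a))
  simpa [← map_star, tmul_star, unitB_star] using this

/-- An isometric covariant pair `(π, W)` of `(B ⊗ A, γ)` gives the partial-isometric covariant pair
`(π(1 ⊗ ·), W^*)` of `(A, α)`. -/
theorem toPiso (h : IsIsoCovariant (gammaAction α) π W) (hπ : Separating π) :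
    IsPisoCovariant (endAction α) (π.comp oneTensor) (fun s => star (W s)) where
  isRep :=
    { partialIsometry := fun s => by
        simp only [star_star, h.isRep.isometry, one_mul]
      map_add := fun s t => by
        rw [add_comm, h.isRep.map_add, star_mul] }
  covariant := fun s a => by
    change π (oneTensor (α (.ofAdd s) a)) = star (W s) * π (oneTensor a) * star (star (W s))
    rw [h.star_mul_oneTensor hπ, star_star, mul_assoc, h.isRep.isometry, mul_one]
  commute := fun s a => by
    change star (star (W s)) * star (W s) * π (oneTensor a) =
      π (oneTensor a) * (star (star (W s)) * star (W s))
    rw [star_star, h.rangeProj_mul hπ, h.mul_rangeProj hπ]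

end PisoCP.IsIsoCovariant

end IsoPairs

/-! ### Generators of `B_{Γ⁺} ⊗ A` -/

section BTensorDense

variable {Γ : Type v} [AddCommGroup Γ] [LinearOrder Γ] [IsOrderedAddMonoid Γ]
  {A : Type u} [NonUnitalCStarAlgebra A]

theorem norm_incl (F : BTensor Γ A) : ‖BTensor.incl F‖ = ‖F‖ := rfl

theorem incl_tmul_unitB (s : PosCone Γ) (a : A) (x : PosCone Γ) :
    BTensor.incl (tmul (unitB s) a) x = if s ≤ x then a else 0 := by
  rw [incl_tmul, elemTensor_apply]
  change charFn s x • a = _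
  rw [charFn_apply]
  split_ifs <;> simp

theorem unitB_mul (s t : PosCone Γ) : unitB s * unitB t = unitB (max s t) :=
  BAlg.incl_injective (charFn_mul s t)

theorem dense_span_unitB :
    Dense (Submodule.span ℂ (Set.range (unitB (Γ := Γ))) : Set (BAlg Γ)) := by
  intro f
  have hf : BAlg.incl f ∈ closure (BAlg.incl ''
      (Submodule.span ℂ (Set.range (unitB (Γ := Γ))) : Set (BAlg Γ))) := by
    refine closure_mono ?_ f.2
    intro g hg
    refine Submodule.span_induction (p := fun g _ => g ∈ BAlg.incl ''
      (Submodule.span ℂ (Set.range (unitB (Γ := Γ))) : Set (BAlg Γ))) ?_ ?_ ?_ ?_ hg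
    · rintro _ ⟨s, rfl⟩
      exact ⟨unitB s, Submodule.subset_span ⟨s, rfl⟩, rfl⟩
    · exact ⟨0, Submodule.zero_mem _, map_zero _⟩
    · rintro _ _ _ _ ⟨a, ha, rfl⟩ ⟨b, hb, rfl⟩
      exact ⟨a + b, Submodule.add_mem _ ha hb, map_add _ _ _⟩
    · rintro r _ _ ⟨a, ha, rfl⟩
      exact ⟨r • a, Submodule.smul_mem _ r ha, map_smul _ _ _⟩
  exact closure_subtype.2 hf

theorem norm_tmul_le (f : BAlg Γ) (a : A) : ‖tmul f a‖ ≤ ‖f‖ * ‖a‖ := by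
  rw [← norm_incl, incl_tmul]
  refine lp.norm_le_of_forall_le (by positivity) fun x => ?_
  rw [elemTensor_apply, norm_smul]
  exact mul_le_mul_of_nonneg_right
    (lp.norm_apply_le_norm ENNReal.top_ne_zero (BAlg.incl f) x) (norm_nonneg a)

theorem continuous_tmul_left (a : A) : Continuous fun f : BAlg Γ => tmul f a :=
  AddMonoidHomClass.continuous_of_bound ((tmulBilin Γ A).flip a) ‖a‖ fun f => by
    rw [mul_comm]
    exact norm_tmul_le f a

theorem continuous_tmul_right (f : BAlg Γ) : Continuous fun a : A => tmul f a :=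
  AddMonoidHomClass.continuous_of_bound (tmulBilin Γ A f) ‖f‖ fun a => norm_tmul_le f a

theorem dense_span_tmul : Dense (Submodule.span ℂ
    (Set.range fun p : BAlg Γ × A => tmul p.1 p.2) : Set (BTensor Γ A)) := by
  refine (ofAlgTensor_dense (Γ := Γ) (A := A)).mono ?_
  rintro _ ⟨t, rfl⟩
  induction t with
  | zero => rw [LinearMap.map_zero]; exact Submodule.zero_mem _
  | tmul f a => exact Submodule.subset_span ⟨(f, a), rfl⟩
  | add s t hs ht => rw [LinearMap.map_add]; exact Submodule.add_mem _ hs ht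

theorem dense_span_tmul_unitB : Dense (Submodule.span ℂ
    (Set.range fun p : PosCone Γ × A => tmul (unitB p.1) p.2) : Set (BTensor Γ A)) := by
  refine Dense.of_span_subset_closure dense_span_tmul ?_
  rintro _ ⟨⟨f, a⟩, rfl⟩
  change tmul f a ∈ _
  refine map_mem_closure (f := fun f => tmul f a) (continuous_tmul_left a) (dense_span_unitB f)
    fun g hg => ?_
  refine Submodule.span_induction (p := fun g _ => tmul g a ∈ Submodule.span ℂ
    (Set.range fun p : PosCone Γ × A => tmul (unitB p.1) p.2)) ?_ ?_ ?_ ?_ hg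
  · rintro _ ⟨s, rfl⟩
    exact Submodule.subset_span ⟨(s, a), rfl⟩
  · rw [show tmul (0 : BAlg Γ) a = 0 from ((tmulBilin Γ A).flip a).map_zero]
    exact Submodule.zero_mem _
  · intro x y _ _ hx hy
    rw [show tmul (x + y) a = tmul x a + tmul y a from ((tmulBilin Γ A).flip a).map_add x y]
    exact Submodule.add_mem _ hx hy
  · intro r x _ hx
    rw [show tmul (r • x) a = r • tmul x a from ((tmulBilin Γ A).flip a).map_smul r x]
    exact Submodule.smul_mem _ _ hx

theorem nondegenerateHom_oneTensor : NondegenerateHom (oneTensor (Γ := Γ) (A := A)) := by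
  refine Dense.of_span_subset_closure dense_span_tmul_unitB ?_
  rintro _ ⟨⟨s, a⟩, rfl⟩
  change tmul (unitB s) a ∈ _
  refine map_mem_closure (f := fun a => tmul (unitB s) a)
    (continuous_tmul_right (unitB s)) (CStarAlgebra.mem_closure_mul a) ?_
  rintro _ ⟨e, rfl⟩
  refine Submodule.subset_span ⟨e, tmul (unitB s) a, ?_⟩
  change _ = tmul (unitB 0) e * tmul (unitB s) a
  rw [tmul_mul, unitB_zero_mul]

end BTensorDense

/-! ### From partial-isometric pairs of `A` to isometric pairs of `B_{Γ⁺} ⊗ A` -/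

section Bound

variable {Γ : Type v} [AddCommGroup Γ] [LinearOrder Γ] [IsOrderedAddMonoid Γ]
  {A : Type u} [NonUnitalCStarAlgebra A] {α : Multiplicative (PosCone Γ) →* (A ≃⋆ₐ[ℂ] A)}

/-- The image `V_s^* V_s π(a)` of `1_s ⊗ a` under the representation of `B_{Γ⁺} ⊗ A` determined by a
partial-isometric covariant pair of `A`. -/
def projElem {M : Type w} [Mul M] [Star M] (π : A → M) (V : PosCone Γ → M)
    (p : PosCone Γ × A) : M :=
  star (V p.1) * V p.1 * π p.2

section Algebraic

variable {M : Type w} [Ring M] [StarRing M] [Algebra ℂ M] {π : A →⋆ₙₐ[ℂ] M} {V : PosCone Γ → M}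

theorem PisoCP.IsPisoCovariant.initialProj_mul_max (h : IsPisoCovariant (endAction α) π V)
    (hπ : Separating π) (s t : PosCone Γ) :
    star (V s) * V s * (star (V t) * V t) = star (V (max s t)) * V (max s t) := by
  rcases le_total s t with hst | hst
  · rw [h.initialProj_mul hπ hst, max_eq_right hst]
  · rw [h.initialProj_mul' hπ hst, max_eq_left hst]

theorem PisoCP.IsPisoCovariant.projElem_mul (h : IsPisoCovariant (endAction α) π V)
    (hπ : Separating π) (p q : PosCone Γ × A) :
    projElem π V p * projElem π V q = projElem π V (max p.1 q.1, p.2 * q.2) := by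
  have h1 := h.commute q.1 p.2
  calc projElem π V p * projElem π V q
      = star (V p.1) * V p.1 * (π p.2 * (star (V q.1) * V q.1)) * π q.2 := by
        simp only [projElem, mul_assoc]
    _ = star (V p.1) * V p.1 * (star (V q.1) * V q.1) * (π p.2 * π q.2) := by
        rw [← h1]
        simp only [mul_assoc]
    _ = _ := by rw [h.initialProj_mul_max hπ, ← map_mul, projElem]

theorem PisoCP.IsPisoCovariant.star_projElem (h : IsPisoCovariant (endAction α) π V)
    (p : PosCone Γ × A) : star (projElem π V p) = projElem π V (p.1, star p.2) := by
  rw [projElem, projElem, star_mul, star_mul, star_star, ← map_star, ← h.commute]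

end Algebraic

section Norm

variable {H : Type w} [NormedAddCommGroup H] [InnerProductSpace ℂ H] [CompleteSpace H]

theorem norm_sq_eq_of_projection {P : H →L[ℂ] H} (hs : star P = P) (hi : P * P = P) (v : H) :
    ‖v‖ ^ 2 = ‖P v‖ ^ 2 + ‖v - P v‖ ^ 2 := by
  have h1 : inner ℂ (P v) (v - P v) = 0 := by
    have h2 : P (v - P v) = 0 := by
      rw [map_sub, sub_eq_zero]
      exact (congrArg (fun T : H →L[ℂ] H => T v) hi).symm
    have h3 := ContinuousLinearMap.adjoint_inner_left P (v - P v) v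
    rw [← ContinuousLinearMap.star_eq_adjoint, hs, h2, inner_zero_right] at h3
    exact h3
  have h2 := norm_add_sq (𝕜 := ℂ) (P v) (v - P v)
  rw [h1, add_sub_cancel] at h2
  simpa using h2

variable {π : A →⋆ₙₐ[ℂ] (H →L[ℂ] H)} {V : PosCone Γ → (H →L[ℂ] H)}

/-- The operator `∑ P_s π(a_s)`, where `P_s = V_s^* V_s`, is bounded by the supremum over `x` of
`‖∑_{s ≤ x} a_s‖`. The `P_s` form a decreasing chain of projections that commute with `π`; the
induction adds the largest index `m` and splits the space along `P_m`. -/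
theorem PisoCP.IsPisoCovariant.norm_sum_projElem_apply_le
    (h : IsPisoCovariant (endAction α) π V)
    (hπ : Separating π) (a : PosCone Γ → A) {K : ℝ} (hK : 0 ≤ K) (S : Finset (PosCone Γ))
    (hS : ∀ x ∈ S, ‖∑ s ∈ S with s ≤ x, a s‖ ≤ K) (v : H) :
    ‖(∑ s ∈ S, projElem π V (s, a s)) v‖ ≤ K * ‖v‖ := by
  classical
  induction S using Finset.induction_on_max generalizing v with
  | empty => simpa using mul_nonneg hK (norm_nonneg v)
  | insert m S hm ih =>
    have hmS : m ∉ S := fun hh => lt_irrefl _ (hm m hh)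
    have hS' : ∀ x ∈ S, ‖∑ s ∈ S with s ≤ x, a s‖ ≤ K := by
      intro x hx
      have := hS x (Finset.mem_insert_of_mem hx)
      rwa [Finset.filter_insert, if_neg (not_le.2 (hm x hx))] at this
    have hSm : ‖∑ s ∈ insert m S, a s‖ ≤ K := by
      have := hS m (Finset.mem_insert_self _ _)
      rwa [Finset.filter_true_of_mem] at this
      intro x hx
      rcases Finset.mem_insert.1 hx with rfl | hx
      · exact le_rfl
      · exact (hm x hx).le
    set P : H →L[ℂ] H := star (V m) * V m with hP
    set T' := ∑ s ∈ S, projElem π V (s, a s) with hT'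
    set T := ∑ s ∈ insert m S, projElem π V (s, a s) with hT
    have hTT' : T = projElem π V (m, a m) + T' := Finset.sum_insert hmS
    have hPs : star P = P := by simp [hP]
    have hPP : P * P = P := h.initialProj_mul hπ le_rfl
    -- on the range of `P`, all the projections occurring in `T` act as the identity
    have hPT : P * T = π (∑ s ∈ insert m S, a s) * P := by
      rw [hT, Finset.mul_sum, map_sum, Finset.sum_mul]
      refine Finset.sum_congr rfl fun s hs => ?_
      have hsm : s ≤ m := by
        rcases Finset.mem_insert.1 hs with rfl | hs
        · exact le_rfl
        · exact (hm s hs).le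
      rw [projElem, ← mul_assoc, hP, h.initialProj_mul' hπ hsm, h.commute]
    have hPcomm : ∀ s, P * projElem π V (s, a s) = projElem π V (s, a s) * P := by
      intro s
      calc P * projElem π V (s, a s)
          = star (V m) * V m * (star (V s) * V s) * π (a s) := by rw [projElem, ← mul_assoc]
        _ = star (V s) * V s * (star (V m) * V m * π (a s)) := by
          rw [h.initialProj_mul_max hπ, max_comm, ← h.initialProj_mul_max hπ, mul_assoc]
        _ = _ := by rw [h.commute, projElem, ← mul_assoc]
    have hPT' : P * T' = T' * P := by
      rw [hT', Finset.mul_sum, Finset.sum_mul]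
      exact Finset.sum_congr rfl fun s _ => hPcomm s
    -- on the orthogonal complement of the range of `P`, the last summand vanishes
    have hQT : T - P * T = T' * (1 - P) := by
      have h1 : P * projElem π V (m, a m) = projElem π V (m, a m) := by
        rw [projElem, ← mul_assoc, ← hP, hPP]
      rw [hTT', mul_add, h1, hPT', mul_sub, mul_one]
      abel
    have e1 : ‖P (T v)‖ ≤ K * ‖P v‖ := by
      have : P (T v) = π (∑ s ∈ insert m S, a s) (P v) :=
        congrArg (fun T : H →L[ℂ] H => T v) hPT
      rw [this]
      exact ContinuousLinearMap.le_of_opNorm_le _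
        ((NonUnitalStarAlgHom.norm_apply_le π _).trans hSm) _
    have e2 : ‖T v - P (T v)‖ ≤ K * ‖v - P v‖ := by
      have : T v - P (T v) = T' (v - P v) := congrArg (fun T : H →L[ℂ] H => T v) hQT
      rw [this]
      exact ih hS' _
    have e3 : ‖T v‖ ^ 2 ≤ (K * ‖v‖) ^ 2 := by
      rw [norm_sq_eq_of_projection hPs hPP (T v), mul_pow, norm_sq_eq_of_projection hPs hPP v,
        mul_add, ← mul_pow, ← mul_pow]
      exact add_le_add (pow_le_pow_left₀ (norm_nonneg _) e1 2)
        (pow_le_pow_left₀ (norm_nonneg _) e2 2)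
    exact (pow_le_pow_iff_left₀ (norm_nonneg _) (by positivity) two_ne_zero).1 e3

/-- A linear combination of terms `L_x(a)` that are linear in `a`, with the terms collected for
each `x`. -/
theorem linearCombination_prod_eq_sum {X E : Type*} [AddCommGroup E] [Module ℂ E]
    [DecidableEq X] (c : X × A →₀ ℂ) (L : X → A →ₗ[ℂ] E) :
    Finsupp.linearCombination ℂ (fun p : X × A => L p.1 p.2) c =
      ∑ s ∈ c.support.image Prod.fst, L s (∑ p ∈ c.support with p.1 = s, c p • p.2) := by
  rw [Finsupp.linearCombination_apply, Finsupp.sum,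
    ← Finset.sum_fiberwise_of_maps_to (fun p hp => Finset.mem_image_of_mem Prod.fst hp)]
  refine Finset.sum_congr rfl fun s _ => ?_
  rw [map_sum]
  refine Finset.sum_congr rfl fun p hp => ?_
  rw [map_smul, (Finset.mem_filter.1 hp).2]

theorem PisoCP.IsPisoCovariant.norm_linearCombination_projElem_le
    (h : IsPisoCovariant (endAction α) π V) (hπ : Separating π) (c : PosCone Γ × A →₀ ℂ) :
    ‖Finsupp.linearCombination ℂ (projElem π V) c‖ ≤
      ‖Finsupp.linearCombination ℂ (fun p : PosCone Γ × A => tmul (unitB p.1) p.2) c‖ := by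
  classical
  have h1 := linearCombination_prod_eq_sum c
    (fun s => (LinearMap.mulLeft ℂ (star (V s) * V s)) ∘ₗ π.toCLM.toLinearMap)
  have h2 := linearCombination_prod_eq_sum c (fun s => tmulBilin Γ A (unitB s))
  set S := c.support.image Prod.fst
  set a : PosCone Γ → A := fun s => ∑ p ∈ c.support with p.1 = s, c p • p.2
  change Finsupp.linearCombination ℂ (projElem π V) c = ∑ s ∈ S, projElem π V (s, a s) at h1
  change Finsupp.linearCombination ℂ (fun p : PosCone Γ × A => tmul (unitB p.1) p.2) c =
    ∑ s ∈ S, tmul (unitB s) (a s) at h2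
  rw [h1, h2]
  refine ContinuousLinearMap.opNorm_le_bound _ (norm_nonneg _) fun v =>
    h.norm_sum_projElem_apply_le hπ a (norm_nonneg _) S (fun x _ => ?_) v
  have h3 : BTensor.incl (∑ s ∈ S, tmul (unitB s) (a s)) x = ∑ s ∈ S with s ≤ x, a s := by
    rw [map_sum, lp.coeFn_sum, Finset.sum_apply, Finset.sum_filter]
    exact Finset.sum_congr rfl fun s _ => incl_tmul_unitB s (a s) x
  rw [← h3, ← norm_incl]
  exact lp.norm_apply_le_norm ENNReal.top_ne_zero _ x

theorem tmul_unitB_mul (p q : PosCone Γ × A) : tmul (unitB p.1) p.2 * tmul (unitB q.1) q.2 =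
    tmul (unitB (max p.1 q.1)) (p.2 * q.2) := by
  rw [tmul_mul, unitB_mul]

theorem tmul_unitB_star (p : PosCone Γ × A) : star (tmul (unitB p.1) p.2) =
    tmul (unitB p.1) (star p.2) := by
  rw [tmul_star, unitB_star]

theorem PisoCP.IsPisoCovariant.exists_rep_bTensor
    (h : IsPisoCovariant (endAction α) π V) (hπ : Separating π) :
    ∃ πD : BTensor Γ A →⋆ₙₐ[ℂ] (H →L[ℂ] H), ∀ p : PosCone Γ × A,
      πD (tmul (unitB p.1) p.2) = projElem π V p :=
  exists_starAlgHom_of_norm_le (fun p : PosCone Γ × A => tmul (unitB p.1) p.2) (projElem π V)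
    (fun p q => ⟨(max p.1 q.1, p.2 * q.2), tmul_unitB_mul p q, h.projElem_mul hπ p q⟩)
    (fun p => ⟨(p.1, star p.2), tmul_unitB_star p, h.star_projElem p⟩)
    dense_span_tmul_unitB (h.norm_linearCombination_projElem_le hπ)

end Norm

section Multiplier

variable {P : Type w} [NonUnitalCStarAlgebra P]

theorem PisoCP.IsPisoCovariant.map_rep {H : Type*} [NormedAddCommGroup H] [InnerProductSpace ℂ H]
    [CompleteSpace H] {M : Type*} [Ring M] [StarRing M] [Algebra ℂ M] {π : A →⋆ₙₐ[ℂ] M}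
    {V : PosCone Γ → M} (h : IsPisoCovariant (endAction α) π V) (ρ : M →⋆ₙₐ[ℂ] (H →L[ℂ] H)) :
    IsPisoCovariant (endAction α) (ρ.comp π) (fun s => ρ (V s)) where
  isRep :=
    { partialIsometry := fun s => by
        rw [← map_star, ← map_mul, ← map_mul, h.isRep.partialIsometry]
      map_add := fun s t => by rw [h.isRep.map_add, map_mul] }
  covariant := fun s a => by
    change ρ (π (endAction α (.ofAdd s) a)) = ρ (V s) * ρ (π a) * star (ρ (V s))
    rw [h.covariant, map_mul, map_mul, map_star]
  commute := fun s a => by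
    change star (ρ (V s)) * ρ (V s) * ρ (π a) = ρ (π a) * (star (ρ (V s)) * ρ (V s))
    rw [← map_star, ← map_mul, ← map_mul, ← map_mul, h.commute]

/-- The version of `exists_rep_bTensor` for a covariant pair in a C*-algebra `P`; the norm
estimate is transported from a representation of `M(P)` that preserves the norm of the element in
question. -/
theorem PisoCP.IsPisoCovariant.exists_hom_bTensor {iA : A →⋆ₙₐ[ℂ] P} {iΓ : PosCone Γ → 𝓜(ℂ, P)}
    (h : IsPisoCovariant (endAction α) (fun a => (iA a : 𝓜(ℂ, P))) iΓ)
    (hnd : NondegenerateHom iA) :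
    ∃ jD : BTensor Γ A →⋆ₙₐ[ℂ] P, ∀ p : PosCone Γ × A,
      (jD (tmul (unitB p.1) p.2) : 𝓜(ℂ, P)) = projElem (fun a => (iA a : 𝓜(ℂ, P))) iΓ p := by
  set ι : P →⋆ₙₐ[ℂ] 𝓜(ℂ, P) := DoubleCentralizer.coeHom (𝕜 := ℂ)
  have h' : IsPisoCovariant (endAction α) (ι.comp iA) iΓ := h
  have hsep := hnd.separating
  set g : PosCone Γ × A → P := fun p => (star (iΓ p.1) * iΓ p.1).fst (iA p.2) with hg
  have hgM : ∀ p, ι (g p) = projElem (ι.comp iA) iΓ p := fun p =>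
    DoubleCentralizer.coe_fst_apply _ _
  have hinj : Function.Injective ι := DoubleCentralizer.coe_injective
  obtain ⟨jD, hj⟩ := exists_starAlgHom_of_norm_le
    (fun p : PosCone Γ × A => tmul (unitB p.1) p.2) g
    (fun p q => ⟨(max p.1 q.1, p.2 * q.2), tmul_unitB_mul p q, hinj <| by
      rw [map_mul, hgM, hgM, hgM, h'.projElem_mul hsep]⟩)
    (fun p => ⟨(p.1, star p.2), tmul_unitB_star p, hinj <| by
      rw [map_star, hgM, hgM, h'.star_projElem]⟩)
    dense_span_tmul_unitB (fun c => by
      obtain ⟨H, _, _, _, ρ, hρ, hle⟩ :=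
        exists_nondegenerateRep_norm_le (Finsupp.linearCombination ℂ g c)
      refine hle.trans ?_
      have h1 := (h'.map_rep ρ).norm_linearCombination_projElem_le
        (hρ.comp hnd).separating c
      refine le_trans (le_of_eq ?_) h1
      congr 1
      change (ρ.comp ι).toCLM.toLinearMap _ = _
      rw [Finsupp.apply_linearCombination]
      congr 2
      funext p
      change ρ (ι (g p)) = star (ρ (iΓ p.1)) * ρ (iΓ p.1) * ρ (ι (iA p.2))
      rw [hgM, ← map_star, ← map_mul, ← map_mul]
      rfl)
  exact ⟨jD, fun p => by rw [hj]; exact hgM p⟩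

/-- If `π_D` is the homomorphism of `B_{Γ⁺} ⊗ A` with `π_D(1_s ⊗ a) = V_s^* V_s π(a)`, then
`(π_D, V^*)` is an isometric covariant pair. -/
theorem PisoCP.IsPisoCovariant.toIso {M : Type w} [CStarAlgebra M] {π : A →⋆ₙₐ[ℂ] M}
    {V : PosCone Γ → M} (h : IsPisoCovariant (endAction α) π V) (hπ : Separating π)
    {πD : BTensor Γ A →⋆ₙₐ[ℂ] M}
    (hD : ∀ p : PosCone Γ × A, πD (tmul (unitB p.1) p.2) = projElem π V p) :
    IsIsoCovariant (gammaAction α) πD (fun s => star (V s)) where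
  isRep :=
    { isometry := fun s => by rw [star_star, h.mul_star_self hπ]
      map_add := fun s t => h.star_add s t }
  covariant := fun s F => by
    rw [star_star]
    refine ContinuousLinearMap.eq_of_dense_span dense_span_tmul_unitB
      (T := πD.toCLM.comp (gammaAction α (.ofAdd s)).toCLM)
      (T' := ((ContinuousLinearMap.mul ℂ M).flip (V s)).comp
        ((ContinuousLinearMap.mul ℂ M (star (V s))).comp πD.toCLM)) ?_ F
    rintro _ ⟨⟨t, a⟩, rfl⟩
    change πD (gammaAction α (.ofAdd s) (tmul (unitB t) a)) =
      star (V s) * πD (tmul (unitB t) a) * V s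
    have h1 := hD (t + s, (α (.ofAdd s)).symm a)
    have h2 := hD (t, a)
    have h3 : π a * V s = V s * π ((α (.ofAdd s)).symm a) := by
      rw [h.mul_map, StarAlgEquiv.apply_symm_apply]
    dsimp only at h1 h2
    rw [gammaAction_tmul, tauMap_unitB, h1, h2, projElem, projElem]
    dsimp only
    simp only [mul_assoc]
    rw [h3, add_comm t s, h.star_add, add_comm s t, h.isRep.map_add]
    simp only [mul_assoc]

end Multiplier

end Bound

/-! ### Multipliers of closed spans -/

section ClosedSpan

variable {E : Type u} [NonUnitalCStarAlgebra E] {s : Set E}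
    {hmul : ∀ x ∈ s, ∀ y ∈ s, x * y ∈ s} {hstar : ∀ x ∈ s, star x ∈ s}

theorem map_mem_closedSpan_of_clm {F : Type v} [NonUnitalCStarAlgebra F] {t : Set F}
    {hmul' : ∀ x ∈ t, ∀ y ∈ t, x * y ∈ t} {hstar' : ∀ x ∈ t, star x ∈ t}
    (T : E →L[ℂ] F) (h : ∀ x ∈ s, T x ∈ t) {x : E} (hx : x ∈ closedSpan s hmul hstar) :
    T x ∈ closedSpan t hmul' hstar' := by
  refine map_mem_closure T.continuous hx fun a ha => ?_
  have h1 : (Submodule.span ℂ s).map T.toLinearMap ≤ Submodule.span ℂ t := by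
    rw [Submodule.map_span_le]
    exact fun x hx => Submodule.subset_span (h x hx)
  exact h1 (Submodule.mem_map_of_mem ha)

theorem dense_span_closedSpan : Dense (Submodule.span ℂ
    {x : closedSpan s hmul hstar | (x : E) ∈ s} : Set (closedSpan s hmul hstar)) := by
  intro x
  refine closure_subtype.2 (closure_mono ?_ x.2)
  intro g hg
  refine Submodule.span_induction (p := fun g _ => g ∈ ((↑) : closedSpan s hmul hstar → E) ''
    (Submodule.span ℂ {x : closedSpan s hmul hstar | (x : E) ∈ s} :
      Set (closedSpan s hmul hstar))) ?_ ?_ ?_ ?_ hg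
  · intro x hx
    exact ⟨⟨x, mem_closedSpan_of_mem hx⟩, Submodule.subset_span hx, rfl⟩
  · exact ⟨0, Submodule.zero_mem _, rfl⟩
  · rintro _ _ _ _ ⟨a, ha, rfl⟩ ⟨b, hb, rfl⟩
    exact ⟨a + b, Submodule.add_mem _ ha hb, rfl⟩
  · rintro r _ _ ⟨a, ha, rfl⟩
    exact ⟨r • a, Submodule.smul_mem _ r ha, rfl⟩

theorem NonUnitalStarAlgHom.map_linearCombination {F : Type v} [NonUnitalCStarAlgebra F]
    (φ : E →⋆ₙₐ[ℂ] F) {X : Type w} (f : X → E) (c : X →₀ ℂ) :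
    φ (Finsupp.linearCombination ℂ f c) = Finsupp.linearCombination ℂ (fun x => φ (f x)) c :=
  Finsupp.apply_linearCombination ℂ φ.toCLM.toLinearMap f c

section Multiplier

variable {C : Type v} [NonUnitalCStarAlgebra C] (j : C →⋆ₙₐ[ℂ] E) (hj : Function.Injective j)
  (m : E)
  (hl : ∀ c, ∃ d, j d = m * j c) (hs : ∀ c, ∃ d, j d = star m * j c)

variable {j m} in
theorem map_star_choose (c : C) : j (star (hs (star c)).choose) = j c * m := by
  rw [map_star, (hs (star c)).choose_spec, star_mul, star_star, map_star, star_star]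

/-- An element `m` of a C*-algebra `E` for which `m` and `m^*` multiply an embedded C*-algebra
`j : C → E` from the left into itself, as a multiplier of `C`. -/
noncomputable def multiplierOf : 𝓜(ℂ, C) where
  fst := LinearMap.mkContinuous
    { toFun := fun c => (hl c).choose
      map_add' := fun x y => hj <| by
        rw [(hl _).choose_spec, map_add, map_add, (hl x).choose_spec, (hl y).choose_spec, mul_add]
      map_smul' := fun r x => hj <| by
        rw [(hl _).choose_spec, map_smul, RingHom.id_apply, map_smul, (hl x).choose_spec,
          mul_smul_comm] } ‖m‖
    fun c => by
      change ‖(hl c).choose‖ ≤ _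
      rw [← NonUnitalStarAlgHom.norm_map j hj, (hl c).choose_spec,
        ← NonUnitalStarAlgHom.norm_map j hj c]
      exact norm_mul_le _ _
  snd := LinearMap.mkContinuous
    { toFun := fun c => star (hs (star c)).choose
      map_add' := fun x y => hj <| by
        rw [map_add, map_star_choose hs, map_star_choose hs, map_star_choose hs, map_add, add_mul]
      map_smul' := fun r x => hj <| by
        rw [RingHom.id_apply, map_smul, map_star_choose hs, map_star_choose hs, map_smul,
          smul_mul_assoc] } ‖m‖
    fun c => by
      change ‖star (hs (star c)).choose‖ ≤ _
      rw [← NonUnitalStarAlgHom.norm_map j hj, map_star_choose hs,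
        ← NonUnitalStarAlgHom.norm_map j hj c, mul_comm ‖m‖]
      exact norm_mul_le _ _
  central := fun x y => hj <| by
    change j (star (hs (star x)).choose * y) = j (x * (hl y).choose)
    rw [map_mul, map_mul, map_star_choose hs, (hl y).choose_spec, mul_assoc]

theorem map_multiplierOf_fst (c : C) : j ((multiplierOf j hj m hl hs).fst c) = m * j c :=
  (hl c).choose_spec

theorem map_star_multiplierOf_fst (c : C) :
    j ((star (multiplierOf j hj m hl hs)).fst c) = star m * j c := by
  have h1 : (star (multiplierOf j hj m hl hs)).fst c = (hs c).choose := by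
    rw [DoubleCentralizer.star_fst]
    change star (star (hs (star (star c))).choose) = _
    rw [star_star]
    congr 2
    rw [star_star]
  rw [h1, (hs c).choose_spec]

end Multiplier

end ClosedSpan

/-! ### Existence of partial-isometric crossed products -/

section Existence

variable {Γ : Type v} [AddCommGroup Γ] [LinearOrder Γ] [IsOrderedAddMonoid Γ]
  {A : Type u} [NonUnitalCStarAlgebra A] (α : Multiplicative (PosCone Γ) →* (A ≃⋆ₐ[ℂ] A))

/-- A covariant partial-isometric representation of `(A, Γ⁺, α)` on a Hilbert space. -/
structure PisoRep where
  /-- the Hilbert space -/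
  H : Type w
  [normed : NormedAddCommGroup H]
  [inner : InnerProductSpace ℂ H]
  [complete : CompleteSpace H]
  /-- the representation of the algebra -/
  π : A →⋆ₙₐ[ℂ] (H →L[ℂ] H)
  /-- the representation of the semigroup -/
  V : PosCone Γ → (H →L[ℂ] H)
  nondegenerate : NondegenerateRep π
  covariant : IsPisoCovariant (endAction α) π V

attribute [instance] PisoRep.normed PisoRep.inner PisoRep.complete

variable {α}

namespace PisoRep

variable (R : PisoRep.{u, v, w} α)

theorem norm_V_le (s : PosCone Γ) : ‖R.V s‖ ≤ 1 := by
  have h1 := R.covariant.mul_star_self R.nondegenerate.separating s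
  have h2 : ‖R.V s‖ * ‖R.V s‖ ≤ 1 := by
    rw [← CStarRing.norm_self_mul_star, h1]
    exact ContinuousLinearMap.norm_id_le
  nlinarith [norm_nonneg (R.V s)]

/-- The C*-seminorm on formal combinations of spanning elements that a covariant representation
induces. -/
noncomputable def seminorm (c : PisoIndex Γ A →₀ ℂ) : ℝ :=
  ‖Finsupp.linearCombination ℂ (pisoElem R.π R.V) c‖

end PisoRep

namespace PisoFamily

noncomputable section

variable {I : Type w} (R : I → PisoRep.{u, v, w} α)

/-- The product C*-algebra `∏ B(H_i)`. -/
abbrev Product : Type w := lp (fun i => (R i).H →L[ℂ] (R i).H) ∞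

/-- The family `(V_i(s))_i`. -/
def V (s : PosCone Γ) : Product R :=
  ⟨fun i => (R i).V s, memℓp_infty ⟨1, by rintro _ ⟨i, rfl⟩; exact (R i).norm_V_le s⟩⟩

/-- The family `(π_i(a))_i`. -/
def π : A →⋆ₙₐ[ℂ] Product R where
  toFun a := ⟨fun i => (R i).π a, memℓp_infty ⟨‖a‖, by
    rintro _ ⟨i, rfl⟩; exact NonUnitalStarAlgHom.norm_apply_le (R i).π a⟩⟩
  map_smul' r a := lp.ext (funext fun i => map_smul (R i).π r a)
  map_zero' := lp.ext (funext fun i => map_zero (R i).π)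
  map_add' a b := lp.ext (funext fun i => map_add (R i).π a b)
  map_mul' a b := lp.ext (funext fun i => map_mul (R i).π a b)
  map_star' a := lp.ext (funext fun i => map_star (R i).π a)

/-- The projection of the product onto a factor. -/
def proj (i : I) : Product R →⋆ₙₐ[ℂ] ((R i).H →L[ℂ] (R i).H) where
  toFun x := x i
  map_smul' _ _ := rfl
  map_zero' := rfl
  map_add' _ _ := rfl
  map_mul' _ _ := rfl
  map_star' _ := rfl

theorem covariant : IsPisoCovariant (endAction α) (π R) (V R) where
  isRep :=
    { partialIsometry := fun s => lp.ext (funext fun i => (R i).covariant.isRep.partialIsometry s)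
      map_add := fun s t => lp.ext (funext fun i => (R i).covariant.isRep.map_add s t) }
  covariant := fun s a => lp.ext (funext fun i => (R i).covariant.covariant s a)
  commute := fun s a => lp.ext (funext fun i => (R i).covariant.commute s a)

theorem pisoElem_mul (x y : PisoIndex Γ A) : pisoElem (π R) (V R) x * pisoElem (π R) (V R) y =
    pisoElem (π R) (V R) (x.mul α y) :=
  lp.ext (funext fun i => (R i).covariant.pisoElem_mul (R i).nondegenerate.separating x y)

theorem star_pisoElem (x : PisoIndex Γ A) : star (pisoElem (π R) (V R) x) =
    pisoElem (π R) (V R) x.adj :=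
  lp.ext (funext fun _ => IsPisoCovariant.star_pisoElem x)

/-- The C*-subalgebra spanned by the families `(V_i(s)^* π_i(a) V_i(t))_i`. -/
def algSub : NonUnitalStarSubalgebra ℂ (Product R) :=
  closedSpan (Set.range (pisoElem (π R) (V R)))
    (by rintro _ ⟨x, rfl⟩ _ ⟨y, rfl⟩; exact ⟨_, (pisoElem_mul R x y).symm⟩)
    (by rintro _ ⟨x, rfl⟩; exact ⟨_, (star_pisoElem R x).symm⟩)

instance : IsClosed (algSub R : Set (Product R)) := isClosed_closedSpan _ _ _

/-- The C*-algebra spanned by the families `(V_i(s)^* π_i(a) V_i(t))_i`. -/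
def Alg : Type w := algSub R

instance : NonUnitalCStarAlgebra (Alg R) := inferInstanceAs (NonUnitalCStarAlgebra (algSub R))

/-- The inclusion of the spanned C*-algebra in the product. -/
def incl : Alg R →⋆ₙₐ[ℂ] Product R := NonUnitalStarSubalgebraClass.subtype (algSub R)

theorem incl_injective : Function.Injective (incl R) := Subtype.val_injective

theorem Alg.ext {x y : Alg R} (h : ∀ i, incl R x i = incl R y i) : x = y :=
  incl_injective R (lp.ext (funext h))

/-- The spanning elements, as elements of the C*-algebra they span. -/
def elem (x : PisoIndex Γ A) : Alg R := ⟨pisoElem (π R) (V R) x, mem_closedSpan_of_mem ⟨x, rfl⟩⟩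

theorem incl_elem (x : PisoIndex Γ A) : incl R (elem R x) = pisoElem (π R) (V R) x := rfl

theorem dense_span_elem : Dense (Submodule.span ℂ (Set.range (elem R)) : Set (Alg R)) := by
  refine Dense.of_span_subset_closure (E := Alg R) dense_span_closedSpan ?_
  rintro x ⟨y, hy⟩
  exact subset_closure (Submodule.subset_span ⟨y, Subtype.ext hy⟩)

theorem exists_incl_eq_V_mul (s : PosCone Γ) (c : Alg R) : ∃ d, incl R d = V R s * incl R c := by
  have h : V R s * incl R c ∈ algSub R :=
    map_mem_closedSpan_of_clm (ContinuousLinearMap.mul ℂ (Product R) (V R s))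
      (by
        rintro _ ⟨x, rfl⟩
        exact ⟨x.lmul α s, lp.ext (funext fun i =>
          ((R i).covariant.mul_pisoElem (R i).nondegenerate.separating s x).symm)⟩) c.2
  exact ⟨⟨_, h⟩, rfl⟩

theorem exists_incl_eq_star_V_mul (s : PosCone Γ) (c : Alg R) :
    ∃ d, incl R d = star (V R s) * incl R c := by
  have h : star (V R s) * incl R c ∈ algSub R :=
    map_mem_closedSpan_of_clm (ContinuousLinearMap.mul ℂ (Product R) (star (V R s)))
      (by
        rintro _ ⟨x, rfl⟩
        exact ⟨x.slmul s, lp.ext (funext fun i =>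
          ((R i).covariant.star_mul_pisoElem s x).symm)⟩) c.2
  exact ⟨⟨_, h⟩, rfl⟩

/-- The family `(V_i(s))_i` as a multiplier of the C*-algebra spanned by the families
`(V_i(s)^* π_i(a) V_i(t))_i`. -/
noncomputable def iΓ (s : PosCone Γ) : 𝓜(ℂ, Alg R) :=
  multiplierOf (incl R) (incl_injective R) (V R s) (exists_incl_eq_V_mul R s)
    (exists_incl_eq_star_V_mul R s)

theorem incl_iΓ_fst (s : PosCone Γ) (c : Alg R) : incl R ((iΓ R s).fst c) = V R s * incl R c :=
  map_multiplierOf_fst _ _ _ _ _ c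

theorem incl_star_iΓ_fst (s : PosCone Γ) (c : Alg R) :
    incl R ((star (iΓ R s)).fst c) = star (V R s) * incl R c :=
  map_star_multiplierOf_fst _ _ _ _ _ c

theorem π_eq_pisoElem (a : A) : π R a = pisoElem (π R) (V R) (0, a, 0) :=
  lp.ext (funext fun i =>
    ((R i).covariant.pisoElem_zero_zero (R i).nondegenerate.separating a).symm)

/-- The canonical homomorphism of `A`. -/
noncomputable def iA : A →⋆ₙₐ[ℂ] Alg R :=
  NonUnitalStarAlgHom.codRestrict (π R) (algSub R) fun a =>
    mem_closedSpan_of_mem ⟨(0, a, 0), (π_eq_pisoElem R a).symm⟩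

theorem incl_iA (a : A) : incl R (iA R a) = π R a := rfl

theorem iA_eq_elem (a : A) : iA R a = elem R (0, a, 0) := incl_injective R (π_eq_pisoElem R a)

theorem covariant_multiplier :
    IsPisoCovariant (endAction α) (fun a => (iA R a : 𝓜(ℂ, Alg R))) (iΓ R) where
  isRep :=
    { partialIsometry := fun s => DoubleCentralizer.ext_fst fun c => incl_injective R <| by
        change incl R ((iΓ R s).fst ((star (iΓ R s)).fst ((iΓ R s).fst c))) = _
        rw [incl_iΓ_fst, incl_star_iΓ_fst, incl_iΓ_fst, ← mul_assoc, ← mul_assoc,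
          (covariant R).isRep.partialIsometry]
      map_add := fun s t => DoubleCentralizer.ext_fst fun c => incl_injective R <| by
        change _ = incl R ((iΓ R s).fst ((iΓ R t).fst c))
        rw [incl_iΓ_fst, incl_iΓ_fst, incl_iΓ_fst, (covariant R).isRep.map_add, mul_assoc] }
  covariant := fun s a => DoubleCentralizer.ext_fst fun c => incl_injective R <| by
    change incl R (iA R (endAction α (.ofAdd s) a) * c) =
      incl R ((iΓ R s).fst (iA R a * (star (iΓ R s)).fst c))
    rw [incl_iΓ_fst, map_mul, map_mul, incl_star_iΓ_fst, incl_iA, incl_iA,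
      (covariant R).covariant]
    simp only [mul_assoc]
  commute := fun s a => DoubleCentralizer.ext_fst fun c => incl_injective R <| by
    change incl R ((star (iΓ R s)).fst ((iΓ R s).fst (iA R a * c))) =
      incl R (iA R a * (star (iΓ R s)).fst ((iΓ R s).fst c))
    rw [incl_star_iΓ_fst, incl_iΓ_fst, map_mul, map_mul, incl_star_iΓ_fst, incl_iΓ_fst, incl_iA]
    have := (covariant R).commute s a
    simp only [← mul_assoc]
    rw [this]
    simp only [mul_assoc]

theorem coe_elem (x : PisoIndex Γ A) : (elem R x : 𝓜(ℂ, Alg R)) =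
    star (iΓ R x.1) * (iA R x.2.1 : 𝓜(ℂ, Alg R)) * iΓ R x.2.2 :=
  DoubleCentralizer.ext_fst fun c => incl_injective R <| by
    change incl R (elem R x * c) = incl R ((star (iΓ R x.1)).fst (iA R x.2.1 * (iΓ R x.2.2).fst c))
    rw [incl_star_iΓ_fst, map_mul, map_mul, incl_iΓ_fst, incl_elem, incl_iA, pisoElem]
    simp only [mul_assoc]

theorem nondegenerate : NondegenerateHom (iA R) := by
  refine Dense.of_span_subset_closure (dense_span_elem R) ?_
  rintro _ ⟨⟨s, a, t⟩, rfl⟩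
  have hcont : Continuous fun a => elem R (s, a, t) := by
    have h1 : Continuous fun a => incl R (elem R (s, a, t)) :=
      (continuous_mul_const (V R t)).comp
        ((continuous_const_mul (star (V R s))).comp (π R).continuous_of_cstar)
    exact Continuous.subtype_mk h1 _
  refine map_mem_closure (f := fun a => elem R (s, a, t)) hcont (CStarAlgebra.mem_closure_mul a) ?_
  rintro _ ⟨e, rfl⟩
  refine Submodule.subset_span ⟨(α (.ofAdd s)).symm e, elem R (s, a, t), Alg.ext R fun i => ?_⟩
  have h1 := (R i).covariant.map_mul_star s ((α (.ofAdd s)).symm e)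
  rw [StarAlgEquiv.apply_symm_apply] at h1
  rw [map_mul]
  change star ((R i).V s) * (R i).π (e * a) * (R i).V t =
    (R i).π ((α (.ofAdd s)).symm e) * (star ((R i).V s) * (R i).π a * (R i).V t)
  rw [← mul_assoc, ← mul_assoc, h1, map_mul]
  simp only [mul_assoc]

/-- A covariant representation whose seminorm is that of some member of the family is induced by a
representation of the C*-algebra of the family. -/
theorem exists_rep {S : PisoRep.{u, v, w} α} {i : I} (hi : (R i).seminorm = S.seminorm) :
    ∃ ρ : Alg R →⋆ₙₐ[ℂ] (S.H →L[ℂ] S.H), NondegenerateRep ρ ∧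
      (∀ a, ρ (iA R a) = S.π a) ∧ ∀ s, ExtensionMaps ρ (iΓ R s) (S.V s) := by
  have hsep := S.nondegenerate.separating
  obtain ⟨ρ, hρ⟩ := exists_starAlgHom_of_norm_le (elem R) (pisoElem S.π S.V)
    (fun x y => ⟨x.mul α y, incl_injective R (pisoElem_mul R x y),
      S.covariant.pisoElem_mul hsep x y⟩)
    (fun x => ⟨x.adj, incl_injective R (star_pisoElem R x), IsPisoCovariant.star_pisoElem x⟩)
    (dense_span_elem R) (fun c => by
      have h1 := ((proj R i).comp (incl R)).map_linearCombination (elem R) c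
      have h2 := NonUnitalStarAlgHom.norm_apply_le ((proj R i).comp (incl R))
        (Finsupp.linearCombination ℂ (elem R) c)
      rw [h1] at h2
      change S.seminorm c ≤ _
      rw [← hi]
      exact h2)
  have hA : ∀ a, ρ (iA R a) = S.π a := fun a => by
    rw [iA_eq_elem, hρ, S.covariant.pisoElem_zero_zero hsep]
  refine ⟨ρ, ?_, hA, fun s => ?_⟩
  · refine S.nondegenerate.mono (Submodule.span_mono ?_)
    rintro _ ⟨a, h, rfl⟩
    exact ⟨iA R a, h, by rw [hA]⟩
  · refine ContinuousLinearMap.eq_of_dense_span (dense_span_elem R)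
      (T := (ContinuousLinearMap.mul ℂ _ (S.V s)).comp ρ.toCLM)
      (T' := ρ.toCLM.comp (iΓ R s).fst) ?_
    rintro _ ⟨x, rfl⟩
    have h1 : (iΓ R s).fst (elem R x) = elem R (x.lmul α s) :=
      Alg.ext R fun i => by
        rw [incl_iΓ_fst]
        exact (R i).covariant.mul_pisoElem (R i).nondegenerate.separating s x
    change S.V s * ρ (elem R x) = ρ ((iΓ R s).fst (elem R x))
    rw [h1, hρ, hρ, S.covariant.mul_pisoElem hsep]

end

end PisoFamily

variable (α) in
/-- Every action of `Γ⁺` by automorphisms has a partial-isometric crossed product. The family of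
representations is indexed by the seminorms they induce, which form a set in the right universe. -/
theorem exists_pisoCrossedProduct :
    ∃ (P : Type (max u v)) (_ : NonUnitalCStarAlgebra P) (iA : A →⋆ₙₐ[ℂ] P)
      (iΓ : PosCone Γ → 𝓜(ℂ, P)), IsPisoCrossedProduct (endAction α) iA iΓ := by
  let R : Set.range (PisoRep.seminorm (α := α)) → PisoRep.{u, v, max u v} α := fun i => i.2.choose
  have hR : ∀ i, (R i).seminorm = i := fun i => i.2.choose_spec
  refine ⟨PisoFamily.Alg R, inferInstance, PisoFamily.iA R, PisoFamily.iΓ R, ?_⟩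
  exact
    { nondegenerate := PisoFamily.nondegenerate R
      covariant := PisoFamily.covariant_multiplier R
      universal := fun H _ _ _ π V hπ hV =>
        let S : PisoRep.{u, v, max u v} α := ⟨H, π, V, hπ, hV⟩
        PisoFamily.exists_rep R (S := S) (hR ⟨S.seminorm, S, rfl⟩)
      spanned := by
        refine (PisoFamily.dense_span_elem R).mono (Submodule.span_mono ?_)
        rintro _ ⟨x, rfl⟩
        exact ⟨x.1, x.2.1, x.2.2, PisoFamily.coe_elem R x⟩ }

end Existence

/-! ### Comparison of the two kinds of crossed product -/

section CrossedProducts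

variable {Γ : Type v} [AddCommGroup Γ] [LinearOrder Γ] [IsOrderedAddMonoid Γ]
  {A : Type u} [NonUnitalCStarAlgebra A] {α : Multiplicative (PosCone Γ) →* (A ≃⋆ₐ[ℂ] A)}

section SpanElem

variable {P : Type w} [NonUnitalCStarAlgebra P] (iA : A →⋆ₙₐ[ℂ] P) (iΓ : PosCone Γ → 𝓜(ℂ, P))

/-- The element `iΓ(s)^* iA(a) iΓ(t)` of `P`. -/
noncomputable def spanElem (x : PisoIndex Γ A) : P :=
  (star (iΓ x.1)).fst ((iΓ x.2.2).snd (iA x.2.1))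

theorem coeHom_spanElem (x : PisoIndex Γ A) :
    DoubleCentralizer.coeHom (𝕜 := ℂ) (spanElem iA iΓ x) =
      pisoElem ((DoubleCentralizer.coeHom (𝕜 := ℂ)).comp iA) iΓ x := by
  refine (DoubleCentralizer.coe_fst_apply _ _).trans ?_
  rw [DoubleCentralizer.coe_snd_apply, ← mul_assoc]
  rfl

theorem continuous_spanElem (s t : PosCone Γ) : Continuous fun a => spanElem iA iΓ (s, a, t) :=
  (star (iΓ s)).fst.continuous.comp ((iΓ t).snd.continuous.comp iA.continuous_of_cstar)

variable {iA iΓ}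

theorem spanElem_of_extensionMaps {H : Type*} [NormedAddCommGroup H] [InnerProductSpace ℂ H]
    [CompleteSpace H] {ρ : P →⋆ₙₐ[ℂ] (H →L[ℂ] H)} (hρ : NondegenerateRep ρ)
    {V : PosCone Γ → (H →L[ℂ] H)} (hV : ∀ s, ExtensionMaps ρ (iΓ s) (V s)) (x : PisoIndex Γ A) :
    ρ (spanElem iA iΓ x) = pisoElem (ρ.comp iA) V x := by
  rw [spanElem, ← (hV x.1).star hρ, ← (hV x.2.2).mul_eq hρ, ← mul_assoc]
  rfl

end SpanElem

namespace PisoCP.IsPisoCrossedProduct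

section Single

variable {P : Type w} [NonUnitalCStarAlgebra P] {iA : A →⋆ₙₐ[ℂ] P} {iΓ : PosCone Γ → 𝓜(ℂ, P)}
  (h : IsPisoCrossedProduct (endAction α) iA iΓ)

include h

theorem covariant_coeHom : IsPisoCovariant (endAction α)
    ((DoubleCentralizer.coeHom (𝕜 := ℂ)).comp iA) iΓ := h.covariant

theorem dense_span_spanElem :
    Dense (Submodule.span ℂ (Set.range (spanElem iA iΓ)) : Set P) := by
  refine h.spanned.mono (Submodule.span_mono ?_)
  rintro b ⟨s, a, t, hb⟩
  exact ⟨(s, a, t), DoubleCentralizer.coe_injective ((coeHom_spanElem iA iΓ _).trans hb.symm)⟩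

theorem spanElem_mul (x y : PisoIndex Γ A) :
    spanElem iA iΓ x * spanElem iA iΓ y = spanElem iA iΓ (x.mul α y) :=
  DoubleCentralizer.coe_injective <| by
    change DoubleCentralizer.coeHom (𝕜 := ℂ) (_ * _) = DoubleCentralizer.coeHom (𝕜 := ℂ) _
    rw [map_mul, coeHom_spanElem, coeHom_spanElem, coeHom_spanElem,
      h.covariant_coeHom.pisoElem_mul h.nondegenerate.separating]

omit h in
theorem star_spanElem (x : PisoIndex Γ A) :
    star (spanElem iA iΓ x) = spanElem iA iΓ x.adj :=
  DoubleCentralizer.coe_injective <| by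
    change DoubleCentralizer.coeHom (𝕜 := ℂ) _ = DoubleCentralizer.coeHom (𝕜 := ℂ) _
    rw [map_star, coeHom_spanElem, coeHom_spanElem, IsPisoCovariant.star_pisoElem]

theorem fst_spanElem (s : PosCone Γ) (x : PisoIndex Γ A) :
    (iΓ s).fst (spanElem iA iΓ x) = spanElem iA iΓ (x.lmul α s) :=
  DoubleCentralizer.coe_injective <| by
    change DoubleCentralizer.coe ℂ _ = DoubleCentralizer.coeHom (𝕜 := ℂ) _
    rw [DoubleCentralizer.coe_fst_apply, coeHom_spanElem,
      ← h.covariant_coeHom.mul_pisoElem h.nondegenerate.separating, ← coeHom_spanElem]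
    rfl

theorem spanElem_zero_zero (a : A) : spanElem iA iΓ (0, a, 0) = iA a :=
  DoubleCentralizer.coe_injective <|
    (coeHom_spanElem iA iΓ _).trans
      (h.covariant_coeHom.pisoElem_zero_zero h.nondegenerate.separating a)

end Single

section Comparison

variable {P Q : Type w} [NonUnitalCStarAlgebra P] [NonUnitalCStarAlgebra Q]
  {iA : A →⋆ₙₐ[ℂ] P} {iΓ : PosCone Γ → 𝓜(ℂ, P)} {kA : A →⋆ₙₐ[ℂ] Q} {kΓ : PosCone Γ → 𝓜(ℂ, Q)}

/-- The canonical homomorphism between two crossed products. A representation of `M(Q)` that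
preserves the norm of a given element of `Q` restricts to a covariant representation of the
system, which factors through `P`; so the norm in `Q` is at most that in `P`. -/
theorem exists_hom (h : IsPisoCrossedProduct (endAction α) iA iΓ)
    (k : IsPisoCrossedProduct (endAction α) kA kΓ) :
    ∃ φ : P →⋆ₙₐ[ℂ] Q, ∀ x, φ (spanElem iA iΓ x) = spanElem kA kΓ x := by
  refine exists_starAlgHom_of_norm_le (spanElem iA iΓ) (spanElem kA kΓ)
    (fun x y => ⟨x.mul α y, h.spanElem_mul x y, k.spanElem_mul x y⟩)
    (fun x => ⟨x.adj, star_spanElem x, star_spanElem x⟩) h.dense_span_spanElem fun c => ?_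
  obtain ⟨H, _, _, _, ρ, hρ, hle⟩ :=
    exists_nondegenerateRep_norm_le (Finsupp.linearCombination ℂ (spanElem kA kΓ) c)
  obtain ⟨ρ', hρ', hA, hΓ⟩ := h.universal H
    (ρ.comp ((DoubleCentralizer.coeHom (𝕜 := ℂ)).comp kA)) (fun s => ρ (kΓ s))
    (hρ.comp k.nondegenerate) (k.covariant_coeHom.map_rep ρ)
  have h1 : ∀ x, ρ' (spanElem iA iΓ x) =
      (ρ.comp (DoubleCentralizer.coeHom (𝕜 := ℂ))) (spanElem kA kΓ x) := by
    intro x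
    rw [spanElem_of_extensionMaps hρ' hΓ, NonUnitalStarAlgHom.comp_apply, coeHom_spanElem,
      pisoElem, pisoElem, map_mul, map_mul, map_star]
    congr 2
    exact hA _
  have h2 := NonUnitalStarAlgHom.norm_apply_le ρ' (Finsupp.linearCombination ℂ (spanElem iA iΓ) c)
  rw [ρ'.map_linearCombination] at h2
  simp only [h1] at h2
  rw [← NonUnitalStarAlgHom.map_linearCombination] at h2
  exact hle.trans h2

/-- Two partial-isometric crossed products of the same system are canonically isomorphic. -/
theorem exists_equiv (h : IsPisoCrossedProduct (endAction α) iA iΓ)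
    (k : IsPisoCrossedProduct (endAction α) kA kΓ) :
    ∃ Φ : P ≃⋆ₐ[ℂ] Q, (∀ a, Φ (iA a) = kA a) ∧ ∀ s p, Φ ((iΓ s).fst p) = (kΓ s).fst (Φ p) := by
  obtain ⟨φ, hφ⟩ := h.exists_hom k
  obtain ⟨ψ, hψ⟩ := k.exists_hom h
  have h1 : ∀ p, ψ (φ p) = p := ContinuousLinearMap.eq_of_dense_span h.dense_span_spanElem
    (T := ψ.toCLM.comp φ.toCLM) (T' := ContinuousLinearMap.id ℂ P) (by
      rintro _ ⟨x, rfl⟩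
      change ψ (φ _) = _
      rw [hφ, hψ]
      rfl)
  have h2 : ∀ q, φ (ψ q) = q := ContinuousLinearMap.eq_of_dense_span k.dense_span_spanElem
    (T := φ.toCLM.comp ψ.toCLM) (T' := ContinuousLinearMap.id ℂ Q) (by
      rintro _ ⟨x, rfl⟩
      change φ (ψ _) = _
      rw [hψ, hφ]
      rfl)
  refine ⟨StarAlgEquiv.ofBijective φ
    ⟨Function.LeftInverse.injective h1, Function.RightInverse.surjective h2⟩, fun a => ?_,
    fun s => ?_⟩
  · change φ (iA a) = kA a
    rw [← h.spanElem_zero_zero, hφ, k.spanElem_zero_zero]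
  · refine ContinuousLinearMap.eq_of_dense_span h.dense_span_spanElem
      (T := φ.toCLM.comp (iΓ s).fst) (T' := (kΓ s).fst.comp φ.toCLM) ?_
    rintro _ ⟨x, rfl⟩
    change φ ((iΓ s).fst _) = (kΓ s).fst (φ _)
    rw [h.fst_spanElem, hφ, hφ, k.fst_spanElem]

end Comparison

section ToIso

variable {P : Type w} [NonUnitalCStarAlgebra P] {iA : A →⋆ₙₐ[ℂ] P} {iΓ : PosCone Γ → 𝓜(ℂ, P)}

/-- If `S` contains the elements `iA(a) iΓ(s)^*`, then it generates `P`: `iΓ(s)^* iA(a b) iΓ(t)`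
is the product of `iΓ(s)^* iA(a)` and the adjoint of `iΓ(t)^* iA(b^*)`, and
`iΓ(s)^* iA(α_s a) = iA(a) iΓ(s)^*`. -/
theorem dense_adjoin (h : IsPisoCrossedProduct (endAction α) iA iΓ) {S : Set P}
    (hS : ∀ s a, ∃ b ∈ S, (b : 𝓜(ℂ, P)) = (iA a : 𝓜(ℂ, P)) * star (iΓ s)) :
    Dense (NonUnitalStarAlgebra.adjoin ℂ S : Set P) := by
  set K := NonUnitalStarAlgebra.adjoin ℂ S with hK
  let ι : P →⋆ₙₐ[ℂ] 𝓜(ℂ, P) := DoubleCentralizer.coeHom (𝕜 := ℂ)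
  have hmem : ∀ s a, ∃ b ∈ K, ι b = star (iΓ s) * ι (iA a) := by
    intro s a
    obtain ⟨b, hb, hbe⟩ := hS s ((α (.ofAdd s)).symm a)
    refine ⟨b, NonUnitalStarAlgebra.subset_adjoin ℂ S hb, hbe.trans ?_⟩
    refine (h.covariant_coeHom.map_mul_star s _).trans ?_
    rw [StarAlgEquiv.apply_symm_apply]
    rfl
  have hle : Submodule.span ℂ (Set.range (spanElem iA iΓ)) ≤
      K.toNonUnitalSubalgebra.toSubmodule.topologicalClosure := by
    refine Submodule.span_le.2 ?_
    rintro _ ⟨⟨s, a, t⟩, rfl⟩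
    refine map_mem_closure (f := fun a => spanElem iA iΓ (s, a, t))
      (continuous_spanElem iA iΓ s t) (CStarAlgebra.mem_closure_mul a) ?_
    rintro _ ⟨e, rfl⟩
    obtain ⟨b, hb, hbe⟩ := hmem s e
    obtain ⟨d, hd, hde⟩ := hmem t (star a)
    have h1 : spanElem iA iΓ (s, e * a, t) = b * star d := by
      refine DoubleCentralizer.coe_injective ?_
      change ι _ = ι _
      rw [map_mul, map_star, hbe, hde, coeHom_spanElem, pisoElem]
      simp only [NonUnitalStarAlgHom.comp_apply, map_mul, star_mul, star_star, map_star, mul_assoc]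
      rfl
    change spanElem iA iΓ (s, e * a, t) ∈ K
    rw [h1]
    exact mul_mem hb (star_mem hd)
  exact dense_closure.1 (h.dense_span_spanElem.mono hle)

/-- A partial-isometric crossed product of `(A, Γ⁺, α)` is an isometric crossed product of
`(B_{Γ⁺} ⊗ A, Γ⁺, γ)`. -/
theorem exists_isoCrossedProduct (h : IsPisoCrossedProduct (endAction α) iA iΓ) :
    ∃ jD : BTensor Γ A →⋆ₙₐ[ℂ] P,
      IsIsoCrossedProduct (gammaAction α) jD fun s => star (iΓ s) := by
  obtain ⟨jD, hjD⟩ := h.covariant.exists_hom_bTensor h.nondegenerate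
  have hsep := h.nondegenerate.separating
  have hone : ∀ a, jD (oneTensor a) = iA a := fun a => DoubleCentralizer.coe_injective <| by
    refine (hjD (0, a)).trans ?_
    have h0 := h.covariant_coeHom.map_zero hsep
    rw [projElem, h0, star_one, one_mul, one_mul]
  refine ⟨jD, ?_, h.covariant_coeHom.toIso hsep
    (πD := (DoubleCentralizer.coeHom (𝕜 := ℂ)).comp jD) hjD, ?_, ?_⟩
  · refine h.nondegenerate.mono (Submodule.span_mono ?_)
    rintro _ ⟨a, b, rfl⟩
    exact ⟨oneTensor a, b, by rw [hone]⟩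
  · intro H _ _ _ π W hπ hW
    obtain ⟨ρ, hρ, hA, hΓ⟩ := h.universal H (π.comp oneTensor) (fun s => star (W s))
      (hπ.comp nondegenerateHom_oneTensor) (hW.toPiso hπ.separating)
    have hΓ' : ∀ s, ExtensionMaps ρ (star (iΓ s)) (W s) := fun s => by
      have := (hΓ s).star hρ
      rwa [star_star] at this
    refine ⟨ρ, hρ, ContinuousLinearMap.eq_of_dense_span dense_span_tmul_unitB
      (T := ρ.toCLM.comp jD.toCLM) (T' := π.toCLM) ?_, hΓ'⟩
    rintro _ ⟨⟨s, a⟩, rfl⟩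
    change ρ (jD (tmul (unitB s) a)) = π (tmul (unitB s) a)
    have h1 : jD (tmul (unitB s) a) = (star (iΓ s)).fst ((iΓ s).fst (iA a)) :=
      DoubleCentralizer.coe_injective <| by
        refine (hjD (s, a)).trans ?_
        change _ = DoubleCentralizer.coe ℂ _
        rw [DoubleCentralizer.coe_fst_apply, DoubleCentralizer.coe_fst_apply, ← mul_assoc]
        rfl
    rw [h1, ← hΓ' s, ← hΓ s, hA, ← mul_assoc]
    exact hW.rangeProj_mul hπ.separating s a
  · refine h.dense_adjoin fun s a =>
      ⟨(star (iΓ s)).snd (iA a), ⟨oneTensor a, s, ?_⟩, DoubleCentralizer.coe_snd_apply _ _⟩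
    rw [hone]
    exact DoubleCentralizer.coe_snd_apply _ _

end ToIso

end PisoCP.IsPisoCrossedProduct

namespace PisoCP.IsIsoCrossedProduct

variable {C : Type w} [NonUnitalCStarAlgebra C] {jD : BTensor Γ A →⋆ₙₐ[ℂ] C}
  {jΓ : PosCone Γ → 𝓜(ℂ, C)}

theorem toPiso_covariant (h : IsIsoCrossedProduct (gammaAction α) jD jΓ) :
    IsPisoCovariant (endAction α)
      ((DoubleCentralizer.coeHom (𝕜 := ℂ)).comp (jD.comp oneTensor)) (fun s => star (jΓ s)) :=
  IsIsoCovariant.toPiso (π := (DoubleCentralizer.coeHom (𝕜 := ℂ)).comp jD) h.covariant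
    h.nondegenerate.separating

theorem dense_span_spanElem (h : IsIsoCrossedProduct (gammaAction α) jD jΓ) :
    Dense (Submodule.span ℂ
      (Set.range (spanElem (jD.comp oneTensor) fun s => star (jΓ s))) : Set C) := by
  let ι : C →⋆ₙₐ[ℂ] 𝓜(ℂ, C) := DoubleCentralizer.coeHom (𝕜 := ℂ)
  have hι : Function.Injective ι := DoubleCentralizer.coe_injective
  set f := spanElem (jD.comp oneTensor) fun s => star (jΓ s) with hf
  have hnd := h.nondegenerate.comp nondegenerateHom_oneTensor
  have hcov := h.toPiso_covariant
  have hsep := hnd.separating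
  have hιf : ∀ x, ι (f x) = pisoElem (ι.comp (jD.comp oneTensor)) (fun s => star (jΓ s)) x :=
    coeHom_spanElem _ _
  have hmul : ∀ x ∈ Set.range f, ∀ y ∈ Set.range f, x * y ∈ Set.range f := by
    rintro _ ⟨x, rfl⟩ _ ⟨y, rfl⟩
    refine ⟨x.mul α y, hι ?_⟩
    rw [map_mul, hιf, hιf, hιf, hcov.pisoElem_mul hsep]
  have hstar : ∀ x ∈ Set.range f, star x ∈ Set.range f := by
    rintro _ ⟨x, rfl⟩
    refine ⟨x.adj, hι ?_⟩
    rw [map_star, hιf, hιf, IsPisoCovariant.star_pisoElem]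
  have hgen : NonUnitalStarAlgebra.adjoin ℂ
      {b : C | ∃ d s, (b : 𝓜(ℂ, C)) = (jD d : 𝓜(ℂ, C)) * jΓ s} ≤
      closedSpan (Set.range f) hmul hstar := by
    refine NonUnitalStarAlgebra.adjoin_le ?_
    rintro b ⟨d, s, hb⟩
    have hb' : b = (jΓ s).snd (jD d) :=
      hι (hb.trans (DoubleCentralizer.coe_snd_apply _ _).symm)
    rw [hb']
    change (jΓ s).snd (jD d) ∈ closure (Submodule.span ℂ (Set.range f) : Set C)
    refine map_mem_closure (f := fun d => (jΓ s).snd (jD d))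
      (((jΓ s).snd.comp jD.toCLM).continuous) (dense_span_tmul_unitB d) fun F hF => ?_
    have hmap : (Submodule.span ℂ (Set.range fun p : PosCone Γ × A => tmul (unitB p.1) p.2)).map
        ((jΓ s).snd.comp jD.toCLM).toLinearMap ≤ Submodule.span ℂ (Set.range f) := by
      rw [Submodule.map_span_le]
      rintro _ ⟨⟨r, a⟩, rfl⟩
      refine Submodule.subset_span
        ⟨PisoIndex.slmul r (PisoIndex.lmul α r (s, α (.ofAdd s) a, 0)), hι ?_⟩
      rw [hιf, ← hcov.star_mul_pisoElem, ← hcov.mul_pisoElem hsep]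
      -- `jΓ(r) jΓ(r)^* jΓ(s) jD(1 ⊗ α_s a) = jΓ(r) jΓ(r)^* jD(1 ⊗ a) jΓ(s)`
      have h1 : pisoElem (ι.comp (jD.comp oneTensor)) (fun s => star (jΓ s))
          (s, α (.ofAdd s) a, 0) = ι (jD (oneTensor a)) * jΓ s := by
        have h2 := hcov.map_mul_star s a
        have h3 := hcov.map_zero hsep
        rw [pisoElem, h3, mul_one, ← h2, star_star]
        rfl
      have h4 := IsIsoCovariant.rangeProj_mul (π := ι.comp jD) h.covariant
        h.nondegenerate.separating r a
      refine Eq.trans ?_ (DoubleCentralizer.coe_snd_apply (jΓ s) (jD (tmul (unitB r) a))).symm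
      rw [h1, star_star, ← mul_assoc, ← mul_assoc]
      exact congrArg (· * jΓ s) h4
    exact hmap (Submodule.mem_map_of_mem hF)
  exact dense_closure.1 (h.generated.mono hgen)

/-- An isometric crossed product of `(B_{Γ⁺} ⊗ A, Γ⁺, γ)` is a partial-isometric crossed product of
`(A, Γ⁺, α)`. -/
theorem toPiso (h : IsIsoCrossedProduct (gammaAction α) jD jΓ) :
    IsPisoCrossedProduct (endAction α) (jD.comp oneTensor) (fun s => star (jΓ s)) where
  nondegenerate := h.nondegenerate.comp nondegenerateHom_oneTensor
  covariant := h.toPiso_covariant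
  universal := by
    intro H _ _ _ π V hπ hV
    have hsep := hπ.separating
    obtain ⟨πD, hD⟩ := hV.exists_rep_bTensor hsep
    have hone : ∀ a, πD (oneTensor a) = π a := fun a => by
      refine (hD (0, a)).trans ?_
      rw [projElem, hV.map_zero hsep, star_one, one_mul, one_mul]
    have hπD : NondegenerateRep πD := by
      refine hπ.mono (Submodule.span_mono ?_)
      rintro _ ⟨a, k, rfl⟩
      exact ⟨oneTensor a, k, by rw [hone]⟩
    obtain ⟨ρ, hρ, hρD, hρΓ⟩ := h.universal H πD (fun s => star (V s)) hπD (hV.toIso hsep hD)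
    refine ⟨ρ, hρ, fun a => (hρD _).trans (hone a), fun s => ?_⟩
    have := (hρΓ s).star hρ
    rwa [star_star] at this
  spanned := by
    refine h.dense_span_spanElem.mono (Submodule.span_mono ?_)
    rintro _ ⟨x, rfl⟩
    exact ⟨x.1, x.2.1, x.2.2, coeHom_spanElem _ _ x⟩

end PisoCP.IsIsoCrossedProduct

end CrossedProducts

/-- The isometric crossed product `(C, j)` of `(B_{Γ⁺} ⊗ A, Γ⁺, γ)` exists, any such `C` together
with `k_A(a) = j(1 ⊗ a)` and `k_{Γ⁺}(x) = j(x)^*` is a partial-isometric crossed product of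
`(A, Γ⁺, α)`, and hence any partial-isometric crossed product of `(A, Γ⁺, α)` is isomorphic to `C`,
by an isomorphism that carries its canonical pair to `(k_A, k_{Γ⁺})`. -/
theorem proposition5p1 {Γ : Type v} [AddCommGroup Γ] [LinearOrder Γ] [IsOrderedAddMonoid Γ]
    {A : Type u} [NonUnitalCStarAlgebra A]
    (α : Multiplicative (PosCone Γ) →* (A ≃⋆ₐ[ℂ] A)) :
    (∃ (C : Type (max u v)) (_ : NonUnitalCStarAlgebra C)
      (jD : BTensor Γ A →⋆ₙₐ[ℂ] C) (jΓ : PosCone Γ → 𝓜(ℂ, C)),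
      IsIsoCrossedProduct (gammaAction α) jD jΓ) ∧
    ∀ (C : Type (max u v)) [NonUnitalCStarAlgebra C]
      (jD : BTensor Γ A →⋆ₙₐ[ℂ] C) (jΓ : PosCone Γ → 𝓜(ℂ, C)),
      IsIsoCrossedProduct (gammaAction α) jD jΓ →
        IsPisoCrossedProduct (endAction α) (jD.comp oneTensor) (fun x => star (jΓ x)) ∧
        ∀ (P : Type (max u v)) [NonUnitalCStarAlgebra P]
          (iA : A →⋆ₙₐ[ℂ] P) (iΓ : PosCone Γ → 𝓜(ℂ, P)),
          IsPisoCrossedProduct (endAction α) iA iΓ →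
            ∃ Φ : P ≃⋆ₐ[ℂ] C, (∀ a, Φ (iA a) = jD (oneTensor a)) ∧
              ∀ x p, Φ ((iΓ x).fst p) = (star (jΓ x)).fst (Φ p) := by
  refine ⟨?_, fun C _ jD jΓ hC => ⟨hC.toPiso, fun P _ iA iΓ hP => hP.exists_equiv hC.toPiso⟩⟩
  obtain ⟨P, _, iA, iΓ, hP⟩ := exists_pisoCrossedProduct α
  obtain ⟨jD, hjD⟩ := hP.exists_isoCrossedProduct
  exact ⟨P, inferInstance, jD, _, hjD⟩
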